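/- Let $d\ge 1$ and $k\ge 2$ be integers, let $\mathbf T^d=\mathbb R^d/\mathbb Z^d$ with its uniform probability measure $dx$, and let $F_{in},F_{out}:\mathbf T^d\to[0,1]$ be measurable functions with $F_{in}(-x)=F_{in}(x)$ and $F_{out}(-x)=F_{out}(x)$ (for instance, functions of the distance of $x$ to $0$). For $F\in\{F_{in},F_{out}\}$ and $z\in\mathbb Z^d$ put $\hat F(z)=\int_{\mathbf T^d}F(x)e^{-2\pi i\langle z,x\rangle}dx$, and let $\mu_{in}=\int F_{in}$, $\mu_{out}=\int F_{out}$. Assume $\mu_{in}>\mu_{out}>0$ and (i) $F_{in}(0)$ and $F_{out}(0)$ are equal to the Fourier series of $F_{in}$ and $F_{out}$ evaluated at $0$, that is, $F(0)=\lim_{N\to\infty}\sum_{z\in\{-N,\dots,N\}^d}\hat F(z)$ for $F\in\{F_{in},F_{out}\}$; (ii) $\hat F_{in}(z)+(k-1)\hat F_{out}(z)\ne\mu_{in}-\mu_{out}$ for all $z\in\mathbb Z^d$; (iii) $\hat F_{in}(z)-\hat F_{out}(z)\ne\mu_{in}-\mu_{out}$ for all $z\in\mathbb Z^d\setminus\{0\}$.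 For $n$ divisible by $k$ let $\sigma_n:\{1,\dots,n\}\to\{1,\dots,k\}$ be a community assignment all of whose $k$ communities have size $n/k$. Let $X_1,\dots,X_n$ be independent and uniform on $\mathbf T^d$ and, given these points, let $G_n$ be the random graph on $\{1,\dots,n\}$ in which the pairs $i<j$ are edges independently of each other, with probability $F_{in}(X_i-X_j)$ if $\sigma_n(i)=\sigma_n(j)$ and $F_{out}(X_i-X_j)$ otherwise. Let $A$ be the adjacency matrix of $G_n$. Fix $\varepsilon>0$. The algorithm takes $A$, $k$, $\mu_{in}$, $\mu_{out}$, chooses $k-1$ eigenvalues $\lambda_1'\ge\dots\ge\lambda_{k-1}'$ of $A$ (counted with multiplicity) that are closest to $\lambda_*=n(\mu_{in}-\mu_{out})/k$, takes a matrix $V\in\mathbb R^{n\times(k-1)}$ whose columns are orthogonal unit eigenvectors of $A$ associated with $\lambda_1',\dots,\lambda_{k-1}'$, and clusters the $n$ rows of $V$ by $(1+\varepsilon)$-approximate $k$-means: it finds a $0/1$ matrix $\hat P\in\{0,1\}^{n\times k}$ with exactly one $1$ in each row and a matrix $\hat Y\in\mathbb R^{k\times(k-1)}$ such that $\|\hat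 P\hat Y-V\|_F^2\le(1+\varepsilon)\min_{P,Y}\|PY-V\|_F^2$, the minimum being over all pairs $(P,Y)$ of this kind. Its output is the labelling $\hat\sigma$ with $\hat\sigma(i)=q$ if $\hat P_{iq}=1$. All choices (of eigenvalues in case of ties, of the eigenvectors, and of the approximate solution) are arbitrary. Let $d_H^*(\sigma,\hat\sigma)$ be the minimum of $|\{i:\sigma(i)\ne\tau(i)\}|$ over all labellings $\tau:\{1,\dots,n\}\to\{1,\dots,k\}$ that induce the same partition as $\hat\sigma$, and let $\ell(\sigma,\hat\sigma)=d_H^*(\sigma,\hat\sigma)/n$. Then the algorithm is weakly consistent: for every such sequence $(\sigma_n)$ and every $\delta>0$, the probability that some possible output $\hat\sigma$ on $G_n$ satisfies $\ell(\sigma_n,\hat\sigma)>\delta$ tends to $0$ as $n\to\infty$ through the multiples of $k$. Moreover, there is a constant $C>0$, which depends only on $d,k,F_{in},F_{out},\varepsilon$, such that for every such sequence $(\sigma_n)$, with probability tending to $1$ as $n\to\infty$ through the multiples of $k$, every possible output $\hat\sigma$ on $G_n$ satisfies $d_H^*(\sigma_n,\hat\sigma)\le C\,k^5\log n$. -/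

import Mathlib

open MeasureTheory Filter Topology

namespace SGBM

noncomputable section

/-- The uniform (normalized Haar) probability measure on the flat torus `𝐓^d = ℝ^d / ℤ^d`. -/
def torusMeasure (d : ℕ) : Measure (UnitAddTorus (Fin d)) :=
  Measure.pi fun _ => AddCircle.haarAddCircle

/-- A connectivity probability function: a measurable `[0,1]`-valued function on the torus, which
takes the same value at `x` and `-x` (so that the probability of the edge `{i, j}` does not depend
on the order of its ends). -/
structure IsConnectivity {d : ℕ} (F : UnitAddTorus (Fin d) → ℝ) : Prop where
  measurable : Measurable F
  mem_Icc : ∀ x, F x ∈ Set.Icc (0 : ℝ) 1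
  even : ∀ x, F (-x) = F x

/-- The expected edge density `∫ F(x) dx`. -/
def density {d : ℕ} (F : UnitAddTorus (Fin d) → ℝ) : ℝ :=
  ∫ x, F x ∂(torusMeasure d)

/-- The Fourier coefficient `∫ F(x) e^{-2πi⟨z,x⟩} dx`. -/
def fourierCoeff {d : ℕ} (F : UnitAddTorus (Fin d) → ℝ) (z : Fin d → ℤ) : ℂ :=
  UnitAddTorus.mFourierCoeff (fun x => (F x : ℂ)) z

/-- `F(0)` is the value of the Fourier series of `F` at `0`, the series over `ℤ^d` being understood
as the limit of its partial sums over the cubes `{-N, …, N}^d`. -/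
def EqFourierSeriesAtZero {d : ℕ} (F : UnitAddTorus (Fin d) → ℝ) : Prop :=
  Tendsto
    (fun N : ℕ => ∑ z ∈ Fintype.piFinset (fun _ : Fin d => Finset.Icc (-(N : ℤ)) (N : ℤ)),
      fourierCoeff F z)
    atTop (𝓝 ((F 0 : ℝ) : ℂ))

/-- The assignment `σ` has `k` communities of the same size `n / k`. -/
def IsBalanced {n k : ℕ} (σ : Fin n → Fin k) : Prop :=
  ∀ q : Fin k, k * (Finset.univ.filter fun i => σ i = q).card = n

/-! ### The random graph -/

/-- The probability of the edge `{i, j}` when the community assignment is `σ` and the positions of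
the vertices are `X`. -/
def edgeProb {d n k : ℕ} (F_in F_out : UnitAddTorus (Fin d) → ℝ) (σ : Fin n → Fin k)
    (X : Fin n → UnitAddTorus (Fin d)) (i j : Fin n) : ℝ :=
  if σ i = σ j then F_in (X i - X j) else F_out (X i - X j)

open Classical in
/-- The probability of the graph `G` given the assignment `σ` and the positions `X`: the edges
`{i, j}`, `i < j`, are drawn independently. -/
def graphProb {d n k : ℕ} (F_in F_out : UnitAddTorus (Fin d) → ℝ) (σ : Fin n → Fin k)
    (X : Fin n → UnitAddTorus (Fin d)) (G : SimpleGraph (Fin n)) : ℝ :=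
  ∏ i : Fin n, ∏ j ∈ Finset.Ioi i,
    if G.Adj i j then edgeProb F_in F_out σ X i j else 1 - edgeProb F_in F_out σ X i j

open Classical in
/-- The law of the random graph of the soft geometric block model with assignment `σ`: the positions
`X 0, …, X (n-1)` are independent and uniform on the torus and, given the positions, the graph is
drawn according to `graphProb`. -/
def law {d n k : ℕ} (F_in F_out : UnitAddTorus (Fin d) → ℝ) (σ : Fin n → Fin k) :
    Measure (SimpleGraph (Fin n)) :=
  ∑ G : SimpleGraph (Fin n),
    (∫⁻ X, ENNReal.ofReal (graphProb F_in F_out σ X G)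
      ∂(Measure.pi fun _ : Fin n => torusMeasure d)) • Measure.dirac G

/-! ### The loss of an estimator -/

/-- The absolute classification error: the least Hamming distance from `σ` to an assignment that
induces the same partition as `σ'`. -/
def absError {n k : ℕ} (σ σ' : Fin n → Fin k) : ℕ :=
  sInf {m : ℕ | ∃ τ : Fin n → Fin k, (∀ i j, τ i = τ j ↔ σ' i = σ' j) ∧ m = hammingDist σ τ}

/-- The loss rate. -/
def lossRate {n k : ℕ} (σ σ' : Fin n → Fin k) : ℝ :=
  (absError σ σ' : ℝ) / n

/-! ### The algorithm -/

open Classical in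
/-- The adjacency matrix, with real entries. -/
def adj {n : ℕ} (G : SimpleGraph (Fin n)) : Matrix (Fin n) (Fin n) ℝ :=
  G.adjMatrix ℝ

theorem adj_isHermitian {n : ℕ} (G : SimpleGraph (Fin n)) : (adj G).IsHermitian := by
  classical
  exact G.isHermitian_adjMatrix ℝ

/-- The columns of `V` are orthogonal unit eigenvectors of the adjacency matrix of `G`, associated
with `r` eigenvalues (counted with multiplicity, in decreasing order) that are closest to `c`. The
full spectrum is listed with multiplicity by `Matrix.IsHermitian.eigenvalues`, and `ι` selects `r`
members of this list; ties are broken arbitrarily. -/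
def IsClosestEigenvectors {n r : ℕ} (G : SimpleGraph (Fin n)) (c : ℝ)
    (V : Matrix (Fin n) (Fin r) ℝ) : Prop :=
  ∃ ι : Fin r ↪ Fin n,
    (∀ j, ∀ i ∉ Set.range ι,
      |(adj_isHermitian G).eigenvalues (ι j) - c| ≤ |(adj_isHermitian G).eigenvalues i - c|) ∧
    Antitone (fun j => (adj_isHermitian G).eigenvalues (ι j)) ∧
    V.transpose * V = 1 ∧
    ∀ j, (adj G).mulVec (fun i => V i j) =
      (adj_isHermitian G).eigenvalues (ι j) • (fun i => V i j)

/-- The `n × k` matrix with entries in `{0,1}` whose row `i` has its only `1` in column `τ i`. -/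
def membership {n k : ℕ} (τ : Fin n → Fin k) : Matrix (Fin n) (Fin k) ℝ :=
  fun i q => if τ i = q then 1 else 0

/-- The squared Frobenius norm. -/
def frobSq {n r : ℕ} (M : Matrix (Fin n) (Fin r) ℝ) : ℝ :=
  ∑ i, ∑ j, M i j ^ 2

/-- `τ` is the clustering of a `(1+η)`-approximate solution of the `k`-means problem for the rows
of `V`, that is, of the problem of minimizing `‖P Y - V‖_F²` over the membership matrices `P` and
the matrices `Y ∈ ℝ^{k × r}` of centers. -/
def IsApproxKMeans {n k r : ℕ} (η : ℝ) (V : Matrix (Fin n) (Fin r) ℝ) (τ : Fin n → Fin k) : Prop :=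
  ∃ Y : Matrix (Fin k) (Fin r) ℝ, ∀ (τ' : Fin n → Fin k) (Y' : Matrix (Fin k) (Fin r) ℝ),
    frobSq (membership τ * Y - V) ≤ (1 + η) * frobSq (membership τ' * Y' - V)

/-- `σ'` is a possible output of higher-order spectral clustering on input `G`, `k`, `μ_in`,
`μ_out`: the rows of a matrix of `k - 1` eigenvectors for the eigenvalues closest to
`n (μ_in - μ_out) / k` are clustered by `(1+η)`-approximate `k`-means. -/
def IsOutput {n k : ℕ} (μ_in μ_out η : ℝ) (G : SimpleGraph (Fin n)) (σ' : Fin n → Fin k) : Prop :=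
  ∃ V : Matrix (Fin n) (Fin (k - 1)) ℝ,
    IsClosestEigenvectors G ((n : ℝ) * (μ_in - μ_out) / k) V ∧ IsApproxKMeans η V σ'

end

end SGBM

namespace SGBM
noncomputable section

/-! ### Random graphs with independent edges -/

/-! Put λ = (μ_in − μ_out)/k, let χ_a be the indicator of community a minus 1/k, and e_z(x) =
e^{2πi⟨z,x⟩}. Given the positions, A is the matrix of edge probabilities (with zero diagonal) plus a
centered noise W. Crude second moments show that A is close, at scale n, to a matrix of bounded
rank. The squared Frobenius norm of W² has mean at most 2n³ (`sum_weight_noiseSqNorm_le`), so the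
operator norm of W is o(n) in probability. Since the Fourier series of F_in and F_out converge in
L², truncating them to a suitable finite set S of frequencies costs only a small multiple of n in
Frobenius norm (`integral_truncationError_le`).

Characters diagonalize translation-invariant kernels, so the vectors e_z(X_l) χ_a(σ(l)) and e_z(X_l)
are approximate eigenvectors of A, for n(F̂_in(z) − F̂_out(z))/k and n(F̂_in(z) + (k−1)F̂_out(z))/k;
their squared residuals have mean O(n²) (`integral_freqResidualBound_le`). By (ii) and (iii), all
these values with z in S stay at distance of order n from nλ, except the one belonging to the χ_a at
z = 0, which is exactly nλ.

Counting: a unit eigenvector w with eigenvalue near nλ is almost orthogonal to all the other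
approximate eigenvectors, so its eigenvalue is at most kλ Σ_a ⟨w, χ_a⟩² plus a small multiple of n
(`eigenvalue_le`). For k orthonormal such w, Bessel's inequality and Σ_a ‖χ_a‖² = n(1 − 1/k) bound
the sum of the eigenvalues by about (k−1)λn, whereas this sum is about kλn. Hence at most k−1
eigenvalues are near nλ (`card_near_lt`). No lower bound on their number is needed: the k−1 chosen
columns then span every near eigenvector (`eigvec_mem_span`), so the squared distance from χ_a to
their span is at most ‖(A − nλ)χ_a‖²/(nε)² (`residual_projection_le`), whose mean is O(1).

Let ρ bound the sum of these squared distances. The true communities have k-means cost at most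
(k/n)ρ, with centers at squared distance at least k/n from each other, so at most 8(2+η)ρ vertices
are misclassified (`absError_le`). The error is therefore bounded in probability. Markov's
inequality bounds the probability of an error above L by an arbitrarily small constant plus O(1/n) +
O(1/L) (`law_failure_le`), and L = log n gives both conclusions. -/

open Classical in
/-- The probability of `G` when the edges `{i, j}`, `i < j`, are drawn independently with
probabilities `p i j`. -/
def weight {n : ℕ} (p : Fin n → Fin n → ℝ) (G : SimpleGraph (Fin n)) : ℝ :=
  ∏ i : Fin n, ∏ j ∈ Finset.Ioi i, if G.Adj i j then p i j else 1 - p i j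

/-- The pairs `(i, j)` with `i < j`. -/
def pairs (n : ℕ) : Finset (Fin n × Fin n) := Finset.univ.filter fun e => e.1 < e.2

theorem mem_pairs {n : ℕ} {e : Fin n × Fin n} : e ∈ pairs n ↔ e.1 < e.2 := by simp [pairs]

open Classical in
theorem weight_eq_prod_pairs {n : ℕ} (p : Fin n → Fin n → ℝ) (G : SimpleGraph (Fin n)) :
    weight p G = ∏ e ∈ pairs n, if G.Adj e.1 e.2 then p e.1 e.2 else 1 - p e.1 e.2 := by
  unfold weight pairs
  rw [Finset.prod_filter, ← Finset.univ_product_univ, Finset.prod_product]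
  refine Finset.prod_congr rfl fun i _ => ?_
  rw [← Finset.prod_filter]
  congr 1
  ext j
  simp

theorem weight_nonneg {n : ℕ} {p : Fin n → Fin n → ℝ} (hp : ∀ i j, p i j ∈ Set.Icc (0 : ℝ) 1)
    (G : SimpleGraph (Fin n)) : 0 ≤ weight p G := by
  refine Finset.prod_nonneg fun i _ => Finset.prod_nonneg fun j _ => ?_
  split_ifs
  · exact (hp i j).1
  · linarith [(hp i j).2]

/-- Expanding ∏ (p + (1 − p)) = 1 over the pairs gives a sum over sets of pairs, and graphs
correspond to sets of pairs. -/
theorem sum_weight {n : ℕ} (p : Fin n → Fin n → ℝ) : ∑ G, weight p G = 1 := by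
  classical
  have h := Finset.prod_add (fun e : Fin n × Fin n => p e.1 e.2) (fun e => 1 - p e.1 e.2) (pairs n)
  simp only [add_sub_cancel, Finset.prod_const_one] at h
  rw [h]
  refine Finset.sum_nbij' (fun G => (pairs n).filter fun e => G.Adj e.1 e.2)
    (fun t => SimpleGraph.fromRel fun i j => i < j ∧ (i, j) ∈ t) ?_ ?_ ?_ ?_ ?_
  · intro G _
    simp
  · intro t _
    simp
  · intro G _
    ext i j
    simp only [SimpleGraph.fromRel_adj, Finset.mem_filter, mem_pairs]
    constructor
    · rintro ⟨_, ⟨_, _, h⟩ | ⟨_, _, h⟩⟩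
      · exact h
      · exact h.symm
    · intro h
      refine ⟨h.ne, ?_⟩
      rcases lt_or_gt_of_ne h.ne with hl | hl
      · exact Or.inl ⟨hl, hl, h⟩
      · exact Or.inr ⟨hl, hl, h.symm⟩
  · intro t ht
    rw [Finset.mem_powerset] at ht
    ext ⟨i, j⟩
    simp only [SimpleGraph.fromRel_adj, Finset.mem_filter, mem_pairs]
    constructor
    · rintro ⟨hl, _, ⟨_, h⟩ | ⟨hg, h⟩⟩
      · exact h
      · exact absurd hl hg.asymm
    · intro h
      have hl := mem_pairs.1 (ht h)
      exact ⟨hl, hl.ne, Or.inl ⟨hl, h⟩⟩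
  · intro G _
    rw [weight_eq_prod_pairs, Finset.prod_ite, Finset.filter_not]

/-- The graph obtained from `G` by changing the status of the pair `{i, j}`. -/
def toggle {n : ℕ} (i j : Fin n) (G : SimpleGraph (Fin n)) : SimpleGraph (Fin n) where
  Adj a b := (s(a, b) = s(i, j) ∧ a ≠ b ∧ ¬ G.Adj a b) ∨ (s(a, b) ≠ s(i, j) ∧ G.Adj a b)
  symm := ⟨by
    intro a b h
    rw [Sym2.eq_swap (a := b), G.adj_comm b a, ne_comm (a := b)]
    exact h⟩
  loopless := ⟨by
    intro a h
    simp at h⟩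

theorem toggle_adj_of_ne {n : ℕ} {i j a b : Fin n} (h : s(a, b) ≠ s(i, j))
    (G : SimpleGraph (Fin n)) : (toggle i j G).Adj a b ↔ G.Adj a b := by
  change (_ ∧ _) ∨ (_ ∧ _) ↔ _
  simp only [h, false_and, ne_eq, not_false_eq_true, true_and, false_or]

theorem toggle_adj_self {n : ℕ} {i j : Fin n} (h : i ≠ j) (G : SimpleGraph (Fin n)) :
    (toggle i j G).Adj i j ↔ ¬ G.Adj i j := by
  simp [toggle, h]

theorem toggle_toggle {n : ℕ} {i j : Fin n} (h : i ≠ j) (G : SimpleGraph (Fin n)) :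
    toggle i j (toggle i j G) = G := by
  ext a b
  by_cases hs : s(a, b) = s(i, j)
  · have key : ∀ H : SimpleGraph (Fin n), H.Adj a b ↔ H.Adj i j := fun H => by
      rw [← SimpleGraph.mem_edgeSet, ← SimpleGraph.mem_edgeSet, hs]
    rw [key, key, toggle_adj_self h, toggle_adj_self h, not_not]
  · rw [toggle_adj_of_ne hs, toggle_adj_of_ne hs]

open Classical in
/-- The centered adjacency matrix. -/
def noise {n : ℕ} (p : Fin n → Fin n → ℝ) (G : SimpleGraph (Fin n)) (i j : Fin n) : ℝ :=
  if i = j then 0 else (if G.Adj i j then 1 else 0) - p i j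

theorem noise_self {n : ℕ} (p : Fin n → Fin n → ℝ) (G : SimpleGraph (Fin n)) (i : Fin n) :
    noise p G i i = 0 := by simp [noise]

theorem noise_symm {n : ℕ} {p : Fin n → Fin n → ℝ} (hs : ∀ i j, p i j = p j i)
    (G : SimpleGraph (Fin n)) (i j : Fin n) : noise p G i j = noise p G j i := by
  have h1 := hs i j
  have h2 := G.adj_comm i j
  unfold noise
  grind

theorem abs_noise_le {n : ℕ} {p : Fin n → Fin n → ℝ} (hp : ∀ i j, p i j ∈ Set.Icc (0 : ℝ) 1)
    (G : SimpleGraph (Fin n)) (i j : Fin n) : |noise p G i j| ≤ 1 := by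
  have := hp i j
  simp only [noise, abs_le]
  split_ifs <;> constructor <;> linarith [this.1, this.2]

theorem noise_toggle_of_ne {n : ℕ} {p : Fin n → Fin n → ℝ} {i j a b : Fin n}
    (h : s(a, b) ≠ s(i, j)) (G : SimpleGraph (Fin n)) :
    noise p (toggle i j G) a b = noise p G a b := by
  have h1 := toggle_adj_of_ne h G
  unfold noise
  grind

/-- The involution `toggle i j` cancels the sum in pairs: with and without the edge, the factor of
this pair times the noise is p(1 − p) and (1 − p)(−p), and nothing else changes. -/
theorem sum_weight_noise_mul_of_lt {n : ℕ} {p : Fin n → Fin n → ℝ} {i j : Fin n} (hij : i < j)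
    (f : SimpleGraph (Fin n) → ℝ) (hf : ∀ G, f (toggle i j G) = f G) :
    ∑ G, weight p G * (noise p G i j * f G) = 0 := by
  classical
  refine Finset.sum_involution (fun G _ => toggle i j G) ?_ ?_ (fun _ _ => Finset.mem_univ _)
    (fun G _ => toggle_toggle hij.ne G)
  · intro G _
    rw [hf, weight_eq_prod_pairs, weight_eq_prod_pairs]
    have hm : (i, j) ∈ pairs n := mem_pairs.2 hij
    rw [← Finset.mul_prod_erase _ _ hm, ← Finset.mul_prod_erase _ _ hm]
    -- The factors of the other pairs do not see the toggle.
    have : ∏ e ∈ (pairs n).erase (i, j),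
        (if (toggle i j G).Adj e.1 e.2 then p e.1 e.2 else 1 - p e.1 e.2) =
        ∏ e ∈ (pairs n).erase (i, j), (if G.Adj e.1 e.2 then p e.1 e.2 else 1 - p e.1 e.2) := by
      refine Finset.prod_congr rfl fun e he => ?_
      rw [Finset.mem_erase, mem_pairs] at he
      have : s(e.1, e.2) ≠ s(i, j) := by
        intro h
        rw [Sym2.eq_iff] at h
        rcases h with ⟨h1, h2⟩ | ⟨h1, h2⟩
        · exact he.1 (Prod.ext h1 h2)
        · rw [h1, h2] at he
          exact hij.asymm he.2
      simp only [toggle_adj_of_ne this]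
    rw [this]
    simp only [noise, hij.ne, if_false, toggle_adj_self hij.ne]
    by_cases h : G.Adj i j
    · simp only [h, if_true, not_true_eq_false, if_false]
      ring
    · simp only [h, if_true, not_false_eq_true, if_false]
      ring
  · intro G _ _ h
    have := toggle_adj_self hij.ne G
    rw [h] at this
    exact iff_not_self this

/-- The centered status of a pair is orthogonal to the functions that do not depend on this pair. -/
theorem sum_weight_noise_mul {n : ℕ} {p : Fin n → Fin n → ℝ} (hs : ∀ i j, p i j = p j i)
    {i j : Fin n} (f : SimpleGraph (Fin n) → ℝ) (hf : ∀ G, f (toggle i j G) = f G) :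
    ∑ G, weight p G * (noise p G i j * f G) = 0 := by
  rcases lt_trichotomy i j with h | rfl | h
  · exact sum_weight_noise_mul_of_lt h f hf
  · simp [noise_self]
  · have ht : ∀ G, toggle i j G = toggle j i G := fun G => by
      ext a b
      simp only [toggle, Sym2.eq_swap (a := i)]
    simp only [noise_symm hs _ i j]
    exact sum_weight_noise_mul_of_lt h f fun G => by rw [← ht, hf]

theorem sum_weight_mul_le {n : ℕ} {p : Fin n → Fin n → ℝ} (hp : ∀ i j, p i j ∈ Set.Icc (0 : ℝ) 1)
    {f : SimpleGraph (Fin n) → ℝ} {c : ℝ} (hf : ∀ G, f G ≤ c) : ∑ G, weight p G * f G ≤ c := by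
  calc ∑ G, weight p G * f G ≤ ∑ G, weight p G * c :=
        Finset.sum_le_sum fun G _ => mul_le_mul_of_nonneg_left (hf G) (weight_nonneg hp G)
    _ = c := by rw [← Finset.sum_mul, sum_weight, one_mul]

/-- The second moment of a sum of pairwise orthogonal variables bounded by one. -/
theorem sum_weight_sq_le {n : ℕ} {p : Fin n → Fin n → ℝ} (hp : ∀ i j, p i j ∈ Set.Icc (0 : ℝ) 1)
    (Y : Fin n → SimpleGraph (Fin n) → ℝ) (hY : ∀ l G, |Y l G| ≤ 1)
    (horth : ∀ l l', l ≠ l' → ∑ G, weight p G * (Y l G * Y l' G) = 0) :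
    ∑ G, weight p G * (∑ l, Y l G) ^ 2 ≤ n := by
  have : ∀ G, weight p G * (∑ l, Y l G) ^ 2 =
      ∑ l, ∑ l', weight p G * (Y l G * Y l' G) := fun G => by
    rw [sq, Finset.sum_mul_sum, Finset.mul_sum]
    simp only [Finset.mul_sum]
  simp only [this]
  rw [Finset.sum_comm]
  calc ∑ l, ∑ G, ∑ l', weight p G * (Y l G * Y l' G) ≤ ∑ _l : Fin n, (1 : ℝ) := by
        refine Finset.sum_le_sum fun l _ => ?_
        rw [Finset.sum_comm, Finset.sum_eq_single l (fun l' _ h => horth l l' h.symm)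
          (fun h => absurd (Finset.mem_univ l) h)]
        refine sum_weight_mul_le hp fun G => ?_
        have := hY l G
        rw [← sq, ← sq_abs]
        exact pow_le_one₀ (abs_nonneg _) this
    _ = n := by simp

/-- For distinct l the entries of row i involve distinct pairs {i, l}, so the terms are orthogonal.
-/
theorem sum_weight_noise_sum_sq_le {n : ℕ} {p : Fin n → Fin n → ℝ}
    (hp : ∀ i j, p i j ∈ Set.Icc (0 : ℝ) 1) (hs : ∀ i j, p i j = p j i) (i : Fin n)
    (g : Fin n → ℝ) (hg : ∀ l, |g l| ≤ 1) :
    ∑ G, weight p G * (∑ l, noise p G i l * g l) ^ 2 ≤ n := by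
  refine sum_weight_sq_le hp (fun l G => noise p G i l * g l) ?_ ?_
  · intro l G
    rw [abs_mul]
    exact mul_le_one₀ (abs_noise_le hp G i l) (abs_nonneg _) (hg l)
  · intro l l' h
    have := sum_weight_noise_mul hs (i := i) (j := l)
      (fun G => g l * (noise p G i l' * g l')) (fun G => by
        rw [noise_toggle_of_ne]
        rw [ne_eq, Sym2.eq_iff]
        rintro (⟨_, h2⟩ | ⟨h1, h2⟩)
        · exact h h2.symm
        · exact h (h1 ▸ h2).symm)
    simpa only [mul_assoc] using this

/-- This is an off-diagonal entry of W². Since i ≠ j, the path i–l–j uses the pair {i, l} once and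
the path through another l' avoids it, so the terms are orthogonal. -/
theorem sum_weight_noise_mul_noise_sq_le {n : ℕ} {p : Fin n → Fin n → ℝ}
    (hp : ∀ i j, p i j ∈ Set.Icc (0 : ℝ) 1) (hs : ∀ i j, p i j = p j i) {i j : Fin n}
    (hij : i ≠ j) : ∑ G, weight p G * (∑ l, noise p G i l * noise p G l j) ^ 2 ≤ n := by
  refine sum_weight_sq_le hp (fun l G => noise p G i l * noise p G l j) ?_ ?_
  · intro l G
    rw [abs_mul]
    exact mul_le_one₀ (abs_noise_le hp G i l) (abs_nonneg _) (abs_noise_le hp G l j)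
  · intro l l' h
    -- The degenerate paths vanish because the noise has zero diagonal.
    by_cases hli : l = i
    · subst hli
      simp [noise_self]
    by_cases hlj : l = j
    · subst hlj
      simp [noise_self]
    have := sum_weight_noise_mul hs (i := i) (j := l)
      (fun G => noise p G l j * (noise p G i l' * noise p G l' j)) (fun G => by
        rw [noise_toggle_of_ne, noise_toggle_of_ne, noise_toggle_of_ne]
        · rw [ne_eq, Sym2.eq_iff]
          rintro (⟨_, h2⟩ | ⟨h1, _⟩)
          · exact hlj h2.symm
          · exact h h1.symm
        · rw [ne_eq, Sym2.eq_iff]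
          rintro (⟨_, h2⟩ | ⟨h1, _⟩)
          · exact h h2.symm
          · exact hli h1.symm
        · rw [ne_eq, Sym2.eq_iff]
          rintro (⟨h1, _⟩ | ⟨_, h2⟩)
          · exact hli h1
          · exact hij h2.symm)
    simpa only [mul_assoc] using this

/-- The squared Frobenius norm of the square of the centered adjacency matrix. -/
def noiseSqNorm {n : ℕ} (p : Fin n → Fin n → ℝ) (G : SimpleGraph (Fin n)) : ℝ :=
  ∑ i, ∑ j, (∑ l, noise p G i l * noise p G l j) ^ 2

/-- The off-diagonal entries contribute at most n each by orthogonality, and the n diagonal entries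
at most n² each trivially. The resulting bound n^{3/4} on the operator norm is far from sharp, but
only o(n) is needed. -/
theorem sum_weight_noiseSqNorm_le {n : ℕ} {p : Fin n → Fin n → ℝ}
    (hp : ∀ i j, p i j ∈ Set.Icc (0 : ℝ) 1) (hs : ∀ i j, p i j = p j i) :
    ∑ G, weight p G * noiseSqNorm p G ≤ 2 * (n : ℝ) ^ 3 := by
  have h0 : ∀ i j, ∑ G, weight p G * (∑ l, noise p G i l * noise p G l j) ^ 2 ≤
      n + if i = j then (n : ℝ) ^ 2 else 0 := by
    intro i j
    split_ifs with h
    · refine (sum_weight_mul_le hp (c := (n : ℝ) ^ 2) fun G => ?_).trans (by simp)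
      rw [← sq_abs]
      refine pow_le_pow_left₀ (abs_nonneg _) ?_ 2
      refine (Finset.abs_sum_le_sum_abs _ _).trans ?_
      calc ∑ l, |noise p G i l * noise p G l j| ≤ ∑ _l : Fin n, (1 : ℝ) := by
            refine Finset.sum_le_sum fun l _ => ?_
            rw [abs_mul]
            exact mul_le_one₀ (abs_noise_le hp G i l) (abs_nonneg _) (abs_noise_le hp G l j)
        _ = n := by simp
    · simpa using sum_weight_noise_mul_noise_sq_le hp hs h
  unfold noiseSqNorm
  simp only [Finset.mul_sum]
  rw [Finset.sum_comm]
  calc ∑ i, ∑ G, ∑ j, weight p G * (∑ l, noise p G i l * noise p G l j) ^ 2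
      ≤ ∑ i : Fin n, ∑ j : Fin n, ((n : ℝ) + if i = j then (n : ℝ) ^ 2 else 0) := by
        refine Finset.sum_le_sum fun i _ => ?_
        rw [Finset.sum_comm]
        exact Finset.sum_le_sum fun j _ => h0 i j
    _ = 2 * (n : ℝ) ^ 3 := by
        simp only [Finset.sum_add_distrib, Finset.sum_const, Finset.card_univ, Fintype.card_fin,
          Finset.sum_ite_eq, Finset.mem_univ, if_true, nsmul_eq_mul]
        ring

/-! ### Integrals over the positions -/

instance {d : ℕ} : IsProbabilityMeasure (torusMeasure d) := by
  unfold torusMeasure; infer_instance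

instance {d : ℕ} : (torusMeasure d).IsAddHaarMeasure := by
  unfold torusMeasure; infer_instance

instance {d : ℕ} : (torusMeasure d).IsNegInvariant := by
  have : (torusMeasure d).Regular := inferInstance
  exact Measure.IsAddHaarMeasure.isNegInvariant_of_regular _

/-- The law of the positions of `n` vertices. -/
abbrev positions (d n : ℕ) : Measure (Fin n → UnitAddTorus (Fin d)) :=
  Measure.pi fun _ : Fin n => torusMeasure d

theorem integrable_of_bounded {α : Type*} [MeasurableSpace α] {μ : Measure α} [IsFiniteMeasure μ]
    {f : α → ℝ} (hf : Measurable f) {c : ℝ} (hc : ∀ x, |f x| ≤ c) : Integrable f μ :=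
  Integrable.of_bound hf.aestronglyMeasurable c (ae_of_all _ hc)

theorem integral_le_of_le {α : Type*} [MeasurableSpace α] {μ : Measure α} [IsProbabilityMeasure μ]
    {f : α → ℝ} (hf : Integrable f μ) {c : ℝ} (hc : ∀ x, f x ≤ c) : ∫ x, f x ∂μ ≤ c := by
  calc ∫ x, f x ∂μ ≤ ∫ _x, c ∂μ := integral_mono hf (integrable_const c) hc
    _ = c := by simp

/-- Averaging over the position of one vertex. -/
theorem integral_positions_eq {d n : ℕ} {f : (Fin n → UnitAddTorus (Fin d)) → ℝ}
    (hf : Measurable f) {c : ℝ} (hc : ∀ X, |f X| ≤ c) (l : Fin n) :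
    ∫ X, f X ∂(positions d n) =
      ∫ X, ∫ t, f (X + Pi.single l t) ∂(torusMeasure d) ∂(positions d n) := by
  -- For fixed t, translating the l-th position by t preserves the law of X.
  rw [integral_integral_swap]
  · simp only [integral_add_right_eq_self f, integral_const, probReal_univ, one_smul]
  · refine integrable_of_bounded (c := c) ?_ (fun x => hc _)
    refine hf.comp (measurable_fst.add ?_)
    refine measurable_pi_lambda _ fun j => ?_
    by_cases h : j = l
    · subst h
      simpa using measurable_snd
    · simp [h]

theorem measurable_sub_positions {d n : ℕ} (i j : Fin n) :
    Measurable fun X : Fin n → UnitAddTorus (Fin d) => X i - X j :=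
  (measurable_pi_apply i).sub (measurable_pi_apply j)

/-- Averaging over X_i alone already makes X_i − X_j uniform. -/
theorem integral_positions_pair {d n : ℕ} {i j : Fin n} (hij : i ≠ j)
    {g : UnitAddTorus (Fin d) → ℝ} (hg : Measurable g) {c : ℝ} (hc : ∀ x, |g x| ≤ c) :
    ∫ X, g (X i - X j) ∂(positions d n) = ∫ x, g x ∂(torusMeasure d) := by
  rw [integral_positions_eq (f := fun X => g (X i - X j))
    (hg.comp (measurable_sub_positions i j)) (fun X => hc _) i]
  have : ∀ X : Fin n → UnitAddTorus (Fin d), ∫ t, g ((X + Pi.single i t : Fin n → _) i -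
      (X + Pi.single i t : Fin n → _) j) ∂(torusMeasure d) = ∫ x, g x ∂(torusMeasure d) := fun X => by
    simp only [Pi.add_apply, Pi.single_eq_same, Pi.single_eq_of_ne hij.symm, add_zero]
    simp only [add_sub_right_comm]
    exact integral_add_left_eq_self g _
  simp only [this, integral_const, probReal_univ, one_smul]

/-- Averaging over X_l affects only the first factor, whose mean is zero. -/
theorem integral_positions_orth {d n : ℕ} {i l l' : Fin n} (hl : l ≠ i) (hll : l ≠ l')
    {g h : UnitAddTorus (Fin d) → ℝ} (hg : Measurable g) (hh : Measurable h)
    {c c' : ℝ} (hgc : ∀ x, |g x| ≤ c) (hhc : ∀ x, |h x| ≤ c')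
    (hg0 : ∫ x, g x ∂(torusMeasure d) = 0) :
    ∫ X, g (X i - X l) * h (X i - X l') ∂(positions d n) = 0 := by
  rw [integral_positions_eq (f := fun X => g (X i - X l) * h (X i - X l'))
    ((hg.comp (measurable_sub_positions i l)).mul (hh.comp (measurable_sub_positions i l')))
    (c := c * c') (fun X => by
      rw [abs_mul]
      exact mul_le_mul (hgc _) (hhc _) (abs_nonneg _) ((abs_nonneg _).trans (hgc 0))) l]
  have : ∀ X : Fin n → UnitAddTorus (Fin d), ∫ t,
      g ((X + Pi.single l t : Fin n → _) i - (X + Pi.single l t : Fin n → _) l) *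
        h ((X + Pi.single l t : Fin n → _) i - (X + Pi.single l t : Fin n → _) l')
      ∂(torusMeasure d) = 0 := fun X => by
    simp only [Pi.add_apply, Pi.single_eq_same, Pi.single_eq_of_ne hl.symm,
      Pi.single_eq_of_ne hll.symm, add_zero]
    rw [integral_mul_const]
    simp only [← sub_sub]
    rw [integral_sub_left_eq_self g, hg0, zero_mul]
  simp only [this, integral_zero]

/-- By `integral_positions_orth` only the diagonal terms of the expanded square survive, and each is
at most c². -/
theorem integral_positions_sum_sq_le {d n : ℕ} (i : Fin n)
    {h : Fin n → UnitAddTorus (Fin d) → ℝ} (hh : ∀ l, Measurable (h l)) {c : ℝ}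
    (hc : ∀ l x, |h l x| ≤ c) (h0 : ∀ l, ∫ x, h l x ∂(torusMeasure d) = 0) :
    ∫ X, (∑ l ∈ Finset.univ.erase i, h l (X i - X l)) ^ 2 ∂(positions d n) ≤ n * c ^ 2 := by
  have hm : ∀ l l', Measurable fun X : Fin n → UnitAddTorus (Fin d) =>
      h l (X i - X l) * h l' (X i - X l') := fun l l' =>
    ((hh l).comp (measurable_sub_positions i l)).mul ((hh l').comp (measurable_sub_positions i l'))
  have hb : ∀ l l' (X : Fin n → UnitAddTorus (Fin d)),
      |h l (X i - X l) * h l' (X i - X l')| ≤ c ^ 2 := fun l l' X => by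
    rw [abs_mul, sq]
    exact mul_le_mul (hc _ _) (hc _ _) (abs_nonneg _) ((abs_nonneg _).trans (hc i 0))
  simp only [sq, Finset.sum_mul_sum]
  rw [integral_finsetSum _ fun l _ => integrable_finsetSum _ fun l' _ =>
    integrable_of_bounded (hm l l') (hb l l')]
  calc ∑ l ∈ Finset.univ.erase i, ∫ X, ∑ l' ∈ Finset.univ.erase i,
        h l (X i - X l) * h l' (X i - X l') ∂(positions d n)
      ≤ ∑ _l ∈ Finset.univ.erase i, c ^ 2 := by
        refine Finset.sum_le_sum fun l hl => ?_
        rw [integral_finsetSum _ fun l' _ => integrable_of_bounded (hm l l') (hb l l'),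
          Finset.sum_eq_single_of_mem l hl fun l' _ hll =>
            integral_positions_orth (Finset.ne_of_mem_erase hl) hll.symm (hh l) (hh l')
              (hc l) (hc l') (h0 l)]
        exact integral_le_of_le (integrable_of_bounded (hm l l) (hb l l))
          fun X => (le_abs_self _).trans (hb l l X)
    _ ≤ ∑ _l : Fin n, c ^ 2 :=
        Finset.sum_le_sum_of_subset_of_nonneg (Finset.erase_subset _ _) fun _ _ _ => sq_nonneg c
    _ = n * (c * c) := by simp [sq]

/-! ### Fourier series on the torus -/

theorem fourierCoeff_eq {d : ℕ} (F : UnitAddTorus (Fin d) → ℝ) (z : Fin d → ℤ) :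
    fourierCoeff F z = ∫ x, UnitAddTorus.mFourier (-z) x * (F x : ℂ) ∂(torusMeasure d) := rfl

theorem norm_mFourier_apply {d : ℕ} (z : Fin d → ℤ) (x : UnitAddTorus (Fin d)) :
    ‖UnitAddTorus.mFourier z x‖ = 1 := by
  simp only [UnitAddTorus.mFourier, fourier_apply, ContinuousMap.coe_mk, norm_prod]
  exact Finset.prod_eq_one fun _ _ => Circle.norm_coe _

theorem mFourier_apply_add {d : ℕ} (z : Fin d → ℤ) (x y : UnitAddTorus (Fin d)) :
    UnitAddTorus.mFourier z (x + y) = UnitAddTorus.mFourier z x * UnitAddTorus.mFourier z y := by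
  simp only [UnitAddTorus.mFourier, fourier_apply, ContinuousMap.coe_mk, Pi.add_apply, smul_add,
    ← Finset.prod_mul_distrib]
  exact Finset.prod_congr rfl fun i _ => by rw [AddCircle.toCircle_add, Circle.coe_mul]

theorem mFourier_apply_neg {d : ℕ} (z : Fin d → ℤ) (x : UnitAddTorus (Fin d)) :
    UnitAddTorus.mFourier z (-x) = (starRingEnd ℂ) (UnitAddTorus.mFourier z x) := by
  rw [← UnitAddTorus.mFourier_neg]
  simp [UnitAddTorus.mFourier, fourier_apply]

/-- The partial sum of the Fourier series of `F` over the frequencies in `S`. -/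
def partialFourier {d : ℕ} (F : UnitAddTorus (Fin d) → ℝ) (S : Finset (Fin d → ℤ))
    (x : UnitAddTorus (Fin d)) : ℂ :=
  ∑ z ∈ S, fourierCoeff F z * UnitAddTorus.mFourier z x

theorem IsConnectivity.abs_apply_le {d : ℕ} {F : UnitAddTorus (Fin d) → ℝ} (hF : IsConnectivity F)
    (x : UnitAddTorus (Fin d)) : |F x| ≤ 1 :=
  _root_.abs_le.2 ⟨by linarith [(hF.mem_Icc x).1], (hF.mem_Icc x).2⟩

theorem norm_fourierCoeff_le {d : ℕ} {F : UnitAddTorus (Fin d) → ℝ} (hF : IsConnectivity F)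
    (z : Fin d → ℤ) : ‖fourierCoeff F z‖ ≤ 1 := by
  rw [fourierCoeff_eq]
  refine (norm_integral_le_of_norm_le_const (C := 1) (ae_of_all _ fun x => ?_)).trans (by simp)
  rw [norm_mul, norm_mFourier_apply, one_mul, Complex.norm_real, Real.norm_eq_abs]
  exact hF.abs_apply_le x

theorem fourierCoeff_zero {d : ℕ} (F : UnitAddTorus (Fin d) → ℝ) :
    fourierCoeff F 0 = (density F : ℂ) := by
  rw [fourierCoeff_eq, density]
  simp only [neg_zero, UnitAddTorus.mFourier_zero, ContinuousMap.one_apply, one_mul]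
  exact integral_ofReal

theorem norm_partialFourier_le {d : ℕ} {F : UnitAddTorus (Fin d) → ℝ} (hF : IsConnectivity F)
    (S : Finset (Fin d → ℤ)) (x : UnitAddTorus (Fin d)) : ‖partialFourier F S x‖ ≤ S.card := by
  refine (norm_sum_le _ _).trans ?_
  calc _ ≤ ∑ _z ∈ S, (1 : ℝ) := Finset.sum_le_sum fun z _ => by
        rw [norm_mul, norm_mFourier_apply, mul_one]
        exact norm_fourierCoeff_le hF z
    _ = S.card := by simp

theorem continuous_partialFourier {d : ℕ} (F : UnitAddTorus (Fin d) → ℝ)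
    (S : Finset (Fin d → ℤ)) : Continuous (partialFourier F S) := by
  unfold partialFourier
  fun_prop

-- With normalized Haar measure as the volume of the circle, the volume of the torus unfolds to
-- `torusMeasure`, and the L² theory of `mFourier` applies to it.
local instance : MeasureSpace UnitAddCircle := ⟨AddCircle.haarAddCircle⟩
local instance : Measure.IsAddHaarMeasure (volume : Measure UnitAddCircle) :=
  inferInstanceAs (Measure.IsAddHaarMeasure AddCircle.haarAddCircle)
local instance : IsProbabilityMeasure (volume : Measure UnitAddCircle) :=
  inferInstanceAs (IsProbabilityMeasure AddCircle.haarAddCircle)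

/-- The Fourier series of a bounded function converges in `L²`. -/
theorem tendsto_integral_partialFourier {d : ℕ} {F : UnitAddTorus (Fin d) → ℝ}
    (hF : IsConnectivity F) :
    Tendsto (fun S => ∫ x, ‖(F x : ℂ) - partialFourier F S x‖ ^ 2 ∂(torusMeasure d))
      atTop (𝓝 0) := by
  have hm : MemLp (fun x => (F x : ℂ)) 2 (volume : Measure (UnitAddTorus (Fin d))) :=
    MemLp.of_bound (Complex.measurable_ofReal.comp hF.measurable).aestronglyMeasurable 1
      (ae_of_all _ fun x => by
        rw [Complex.norm_real, Real.norm_eq_abs]; exact hF.abs_apply_le x)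
  have hs := UnitAddTorus.hasSum_mFourier_series_L2 hm.toLp
  have hc : ∀ z, UnitAddTorus.mFourierCoeff (hm.toLp : UnitAddTorus (Fin d) → ℂ) z =
      fourierCoeff F z := fun z => by
    refine integral_congr_ae ?_
    filter_upwards [hm.coeFn_toLp] with x hx
    rw [hx]
  simp only [hc] at hs
  have h1 : Tendsto (fun S : Finset (Fin d → ℤ) => ‖hm.toLp -
      ∑ z ∈ S, fourierCoeff F z • UnitAddTorus.mFourierLp 2 z‖ ^ 2) atTop (𝓝 0) := by
    have h2 := (tendsto_iff_norm_sub_tendsto_zero.1 hs).pow 2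
    simp only [norm_sub_rev _ hm.toLp] at h2
    simpa using h2
  refine h1.congr fun S => ?_
  have hpm : MemLp (partialFourier F S) 2 (volume : Measure (UnitAddTorus (Fin d))) :=
    MemLp.of_bound (continuous_partialFourier F S).aestronglyMeasurable S.card
      (ae_of_all _ fun x => norm_partialFourier_le hF S x)
  -- The partial sum in L² is the class of the pointwise partial sum.
  have h3 : ∑ z ∈ S, fourierCoeff F z • UnitAddTorus.mFourierLp 2 z = hpm.toLp := by
    refine Lp.ext ?_
    have h4 : ∀ z ∈ S, ∀ᵐ x ∂(volume : Measure (UnitAddTorus (Fin d))),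
        (fourierCoeff F z • UnitAddTorus.mFourierLp 2 z : Lp ℂ 2 _) x =
          fourierCoeff F z * UnitAddTorus.mFourier z x := fun z _ => by
      filter_upwards [Lp.coeFn_smul (fourierCoeff F z) (UnitAddTorus.mFourierLp 2 z),
        UnitAddTorus.coeFn_mFourierLp 2 z] with x h5 h6
      rw [h5, Pi.smul_apply, h6, smul_eq_mul]
    filter_upwards [hpm.coeFn_toLp, Lp.coeFn_finsetSum S
      fun z => fourierCoeff F z • UnitAddTorus.mFourierLp 2 z,
      (Finset.eventually_all S).2 h4] with x h5 h6 h7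
    rw [h5, h6, Finset.sum_apply, partialFourier]
    exact Finset.sum_congr rfl h7
  -- The squared L² norm becomes an integral through the complex inner product, hence the passage to
  -- ℂ.
  rw [h3, ← MemLp.toLp_sub hm hpm, ← Complex.ofReal_inj, Complex.ofReal_pow]
  have h5 := inner_self_eq_norm_sq_to_K (𝕜 := ℂ) (hm.sub hpm).toLp
  rw [L2.inner_def] at h5
  refine h5.symm.trans (Eq.trans (integral_congr_ae ?_) integral_ofReal)
  filter_upwards [(hm.sub hpm).coeFn_toLp] with x hx
  rw [hx, Pi.sub_apply, inner_self_eq_norm_sq_to_K]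
  simp

/-! ### Quadratic forms and eigenvectors -/

theorem norm_sum_mul_sq_le {ι : Type*} [Fintype ι] (w : ι → ℝ) (g : ι → ℂ) :
    ‖∑ i, (w i : ℂ) * g i‖ ^ 2 ≤ (∑ i, w i ^ 2) * ∑ i, ‖g i‖ ^ 2 := by
  have h1 : ‖∑ i, (w i : ℂ) * g i‖ ≤ ∑ i, |w i| * ‖g i‖ := by
    refine (norm_sum_le _ _).trans (le_of_eq ?_)
    simp only [norm_mul, Complex.norm_real, Real.norm_eq_abs]
  calc ‖∑ i, (w i : ℂ) * g i‖ ^ 2 ≤ (∑ i, |w i| * ‖g i‖) ^ 2 :=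
        pow_le_pow_left₀ (norm_nonneg _) h1 2
    _ ≤ (∑ i, |w i| ^ 2) * ∑ i, ‖g i‖ ^ 2 := Finset.sum_mul_sq_le_sq_mul_sq _ _ _
    _ = _ := by simp only [sq_abs]

/-- A quadratic form is bounded by the Frobenius norm of its matrix. -/
theorem norm_quadratic_sq_le {ι : Type*} [Fintype ι] (w : ι → ℝ) (hw : ∑ i, w i ^ 2 = 1)
    (M : ι → ι → ℂ) :
    ‖∑ i, ∑ j, (w i : ℂ) * M i j * w j‖ ^ 2 ≤ ∑ i, ∑ j, ‖M i j‖ ^ 2 := by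
  have h1 : ∀ i, ∑ j, (w i : ℂ) * M i j * w j = w i * ∑ j, (w j : ℂ) * M i j := fun i => by
    rw [Finset.mul_sum]
    exact Finset.sum_congr rfl fun j _ => by ring
  simp only [h1]
  refine (norm_sum_mul_sq_le w _).trans ?_
  rw [hw, one_mul]
  refine Finset.sum_le_sum fun i _ => (norm_sum_mul_sq_le w _).trans ?_
  rw [hw, one_mul]

theorem quadratic_sq_le {ι : Type*} [Fintype ι] (w : ι → ℝ) (hw : ∑ i, w i ^ 2 = 1)
    (M : ι → ι → ℝ) : (∑ i, ∑ j, w i * M i j * w j) ^ 2 ≤ ∑ i, ∑ j, M i j ^ 2 := by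
  have h := norm_quadratic_sq_le w hw fun i j => (M i j : ℂ)
  have h2 : ∑ i, ∑ j, (w i : ℂ) * (M i j : ℂ) * w j = ((∑ i, ∑ j, w i * M i j * w j : ℝ) : ℂ) := by
    push_cast
    rfl
  rw [h2] at h
  simpa only [Complex.norm_real, Real.norm_eq_abs, sq_abs] using h

/-- The quadratic form of a symmetric matrix is bounded by the fourth root of the squared
Frobenius norm of its square. -/
theorem quadratic_pow_four_le {ι : Type*} [Fintype ι] (w : ι → ℝ) (hw : ∑ i, w i ^ 2 = 1)
    (M : ι → ι → ℝ) (hM : ∀ i j, M i j = M j i) :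
    (∑ i, ∑ j, w i * M i j * w j) ^ 4 ≤ ∑ i, ∑ j, (∑ l, M i l * M l j) ^ 2 := by
  -- Cauchy–Schwarz gives ⟨w, Mw⟩² ≤ ‖Mw‖², which by symmetry equals ⟨w, M²w⟩; the Frobenius bound
  -- is then applied to M².
  have h1 : (∑ i, ∑ j, w i * M i j * w j) ^ 2 ≤ ∑ l, (∑ j, M l j * w j) ^ 2 := by
    have h2 : ∑ i, ∑ j, w i * M i j * w j = ∑ i, w i * ∑ j, M i j * w j := by
      simp only [Finset.mul_sum, mul_assoc]
    rw [h2]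
    refine (Finset.sum_mul_sq_le_sq_mul_sq _ _ _).trans ?_
    rw [hw, one_mul]
  have h3 : ∑ l, (∑ j, M l j * w j) ^ 2 = ∑ i, ∑ j, w i * (∑ l, M i l * M l j) * w j := by
    have : ∀ l, (∑ j, M l j * w j) ^ 2 = ∑ i, ∑ j, w i * (M i l * M l j) * w j := fun l => by
      rw [sq, Finset.sum_mul_sum]
      refine Finset.sum_congr rfl fun i _ => Finset.sum_congr rfl fun j _ => ?_
      rw [hM l i]
      ring
    simp only [this]
    rw [Finset.sum_comm]
    refine Finset.sum_congr rfl fun i _ => ?_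
    rw [Finset.sum_comm]
    refine Finset.sum_congr rfl fun j _ => ?_
    rw [Finset.mul_sum, Finset.sum_mul]
  calc (∑ i, ∑ j, w i * M i j * w j) ^ 4 = ((∑ i, ∑ j, w i * M i j * w j) ^ 2) ^ 2 := by ring
    _ ≤ (∑ i, ∑ j, w i * (∑ l, M i l * M l j) * w j) ^ 2 := by
        rw [← h3]
        exact pow_le_pow_left₀ (sq_nonneg _) h1 2
    _ ≤ _ := quadratic_sq_le w hw fun i j => ∑ l, M i l * M l j

/-- The squared norm of `(A - ν) g`. -/
def residual {n : ℕ} (G : SimpleGraph (Fin n)) (ν : ℂ) (g : Fin n → ℂ) : ℝ :=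
  ∑ i, ‖(∑ l, (adj G i l : ℂ) * g l) - ν * g i‖ ^ 2

theorem residual_nonneg {n : ℕ} (G : SimpleGraph (Fin n)) (ν : ℂ) (g : Fin n → ℂ) :
    0 ≤ residual G ν g := Finset.sum_nonneg fun _ _ => sq_nonneg _

theorem adj_symm {n : ℕ} (G : SimpleGraph (Fin n)) (i j : Fin n) : adj G i j = adj G j i :=
  (adj_isHermitian G).apply j i

/-- The adjacency matrix is symmetric, so it can be moved onto its eigenvector w. -/
theorem sum_eigenvector_mul {n : ℕ} {G : SimpleGraph (Fin n)} {w : Fin n → ℝ} {Λ : ℝ}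
    (hw : (adj G).mulVec w = Λ • w) (ν : ℂ) (g : Fin n → ℂ) :
    ∑ i, (w i : ℂ) * ((∑ l, (adj G i l : ℂ) * g l) - ν * g i) = (Λ - ν) * ∑ i, (w i : ℂ) * g i := by
  have h1 : ∀ l, ∑ i, (w i : ℂ) * (adj G i l : ℂ) = Λ * w l := fun l => by
    have := congrFun hw l
    simp only [Matrix.mulVec, dotProduct, Pi.smul_apply, smul_eq_mul] at this
    rw [← Complex.ofReal_mul, ← this]
    push_cast
    exact Finset.sum_congr rfl fun i _ => by rw [adj_symm G l i, mul_comm]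
  have h2 : ∑ i, (w i : ℂ) * ∑ l, (adj G i l : ℂ) * g l = ∑ l, (Λ * w l) * g l := by
    simp only [← h1, Finset.mul_sum, Finset.sum_mul]
    rw [Finset.sum_comm]
    simp only [mul_assoc]
  simp only [mul_sub, Finset.sum_sub_distrib, h2]
  rw [sub_mul, Finset.mul_sum, Finset.mul_sum]
  congr 1
  · simp only [mul_assoc]
  · exact Finset.sum_congr rfl fun i _ => by ring

/-- An eigenvector is almost orthogonal to an approximate eigenvector for another eigenvalue. -/
theorem norm_sum_eigenvector_sq_le {n : ℕ} {G : SimpleGraph (Fin n)} {w : Fin n → ℝ} {Λ : ℝ}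
    (hw : (adj G).mulVec w = Λ • w) (hw1 : ∑ i, w i ^ 2 = 1) {ν : ℂ} (g : Fin n → ℂ) {δ : ℝ}
    (hδ : 0 < δ) (hν : δ ≤ ‖(Λ : ℂ) - ν‖) :
    ‖∑ i, (w i : ℂ) * g i‖ ^ 2 ≤ residual G ν g / δ ^ 2 := by
  rw [le_div_iff₀ (pow_pos hδ 2)]
  have h := norm_sum_mul_sq_le w fun i => (∑ l, (adj G i l : ℂ) * g l) - ν * g i
  rw [sum_eigenvector_mul hw, norm_mul, mul_pow, hw1, one_mul] at h
  calc ‖∑ i, (w i : ℂ) * g i‖ ^ 2 * δ ^ 2 = δ ^ 2 * ‖∑ i, (w i : ℂ) * g i‖ ^ 2 := mul_comm _ _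
    _ ≤ ‖(Λ : ℂ) - ν‖ ^ 2 * ‖∑ i, (w i : ℂ) * g i‖ ^ 2 := by gcongr
    _ ≤ _ := h

/-! ### The orthonormal basis of eigenvectors -/

/-- The eigenvector basis of the adjacency matrix. -/
def eigvec {n : ℕ} (G : SimpleGraph (Fin n)) (i : Fin n) : Fin n → ℝ :=
  ((adj_isHermitian G).eigenvectorBasis i).ofLp

/-- The eigenvalues of the adjacency matrix. -/
def eigval {n : ℕ} (G : SimpleGraph (Fin n)) (i : Fin n) : ℝ :=
  (adj_isHermitian G).eigenvalues i

theorem mulVec_eigvec {n : ℕ} (G : SimpleGraph (Fin n)) (i : Fin n) :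
    (adj G).mulVec (eigvec G i) = eigval G i • eigvec G i :=
  (adj_isHermitian G).mulVec_eigenvectorBasis i

theorem sum_eigvec_sq {n : ℕ} (G : SimpleGraph (Fin n)) (i : Fin n) :
    ∑ l, eigvec G i l ^ 2 = 1 := by
  have h := (adj_isHermitian G).eigenvectorBasis.orthonormal.1 i
  have h2 := EuclideanSpace.norm_sq_eq ((adj_isHermitian G).eigenvectorBasis i)
  rw [h] at h2
  simpa [eigvec] using h2.symm

/-- Parseval's identity in the eigenvector basis; the next lemma is Bessel's inequality. -/
theorem sum_eigvec_mul_sq {n : ℕ} (G : SimpleGraph (Fin n)) (u : Fin n → ℝ) :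
    ∑ i, (∑ l, eigvec G i l * u l) ^ 2 = ∑ l, u l ^ 2 := by
  have h := (adj_isHermitian G).eigenvectorBasis.sum_sq_norm_inner_right (WithLp.toLp 2 u)
  rw [EuclideanSpace.norm_sq_eq] at h
  simpa [eigvec, PiLp.inner_apply, mul_comm] using h

theorem sum_eigvec_mul_sq_le {n : ℕ} (G : SimpleGraph (Fin n)) (J : Finset (Fin n))
    (u : Fin n → ℝ) : ∑ i ∈ J, (∑ l, eigvec G i l * u l) ^ 2 ≤ ∑ l, u l ^ 2 := by
  rw [← sum_eigvec_mul_sq G u]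
  exact Finset.sum_le_sum_of_subset_of_nonneg (Finset.subset_univ _) fun _ _ _ => sq_nonneg _

/-! ### The block structure -/

/-- The connectivity function between the communities `a` and `b`. -/
def blockFun {d k : ℕ} (F_in F_out : UnitAddTorus (Fin d) → ℝ) (a b : Fin k) :
    UnitAddTorus (Fin d) → ℝ :=
  if a = b then F_in else F_out

theorem edgeProb_eq {d n k : ℕ} (F_in F_out : UnitAddTorus (Fin d) → ℝ) (σ : Fin n → Fin k)
    (X : Fin n → UnitAddTorus (Fin d)) (i j : Fin n) :
    edgeProb F_in F_out σ X i j = blockFun F_in F_out (σ i) (σ j) (X i - X j) := by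
  unfold edgeProb blockFun
  split_ifs <;> rfl

theorem blockFun_isConnectivity {d k : ℕ} {F_in F_out : UnitAddTorus (Fin d) → ℝ}
    (hF_in : IsConnectivity F_in) (hF_out : IsConnectivity F_out) (a b : Fin k) :
    IsConnectivity (blockFun F_in F_out a b) := by
  unfold blockFun
  split_ifs <;> assumption

/-- The indicator of community `a` minus its mean `1 / k`. -/
def centered {k : ℕ} (a b : Fin k) : ℝ := (if b = a then 1 else 0) - (k : ℝ)⁻¹

/-- The vector with entries `e^{2πi⟨z, X_l⟩} c(σ(l))`. -/
def modulated {d n k : ℕ} (X : Fin n → UnitAddTorus (Fin d)) (σ : Fin n → Fin k)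
    (z : Fin d → ℤ) (c : Fin k → ℝ) (l : Fin n) : ℂ :=
  UnitAddTorus.mFourier z (X l) * (c (σ l) : ℂ)

/-- The k × k matrix with α on the diagonal and β elsewhere acts as α − β on mean-zero vectors and
as α + (k − 1)β on constants. The vector of community sums of y is split into these two parts; no
balance is needed here. -/
theorem sum_block_quadratic {n k : ℕ} (hk : k ≠ 0) (σ : Fin n → Fin k) (y : Fin n → ℂ) (α β : ℂ) :
    ∑ i, ∑ j, (if σ i = σ j then α else β) * (y i * (starRingEnd ℂ) (y j)) =
      (α - β) * ∑ a, (‖∑ l, y l * (centered a (σ l) : ℂ)‖ ^ 2 : ℝ) +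
        (α + (k - 1) * β) / k * (‖∑ l, y l‖ ^ 2 : ℝ) := by
  have hk' : (k : ℂ) ≠ 0 := Nat.cast_ne_zero.2 hk
  set s : ℂ := ∑ l, y l with hs
  set ψ : Fin k → ℂ := fun a => ∑ l, if σ l = a then y l else 0 with hψ
  have hψs : ∑ a, ψ a = s := by
    rw [hψ, Finset.sum_comm]
    simp [hs]
  have hχ : ∀ a, ∑ l, y l * (centered a (σ l) : ℂ) = ψ a - s / k := fun a => by
    simp only [centered, hψ, hs, div_eq_mul_inv, Finset.sum_mul, ← Finset.sum_sub_distrib]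
    refine Finset.sum_congr rfl fun l _ => ?_
    push_cast
    split_ifs <;> simp [mul_sub]
  have h1 : ∑ i, ∑ j, (if σ i = σ j then α else β) * (y i * (starRingEnd ℂ) (y j)) =
      (α - β) * ∑ a, ψ a * (starRingEnd ℂ) (ψ a) + β * (s * (starRingEnd ℂ) s) := by
    have h2 : ∑ a, ψ a * (starRingEnd ℂ) (ψ a) =
        ∑ i, ∑ j, if σ i = σ j then y i * (starRingEnd ℂ) (y j) else 0 := by
      simp only [hψ, map_sum, Finset.sum_mul_sum]
      rw [Finset.sum_comm]
      refine Finset.sum_congr rfl fun i _ => ?_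
      rw [Finset.sum_comm]
      refine Finset.sum_congr rfl fun j _ => ?_
      rw [Finset.sum_eq_single (σ i) (fun b _ hb => by simp [hb.symm]) (by simp)]
      by_cases h : σ i = σ j
      · simp [h]
      · simp [h, Ne.symm h]
    rw [h2, hs, map_sum, Finset.sum_mul_sum, Finset.mul_sum, Finset.mul_sum,
      ← Finset.sum_add_distrib]
    refine Finset.sum_congr rfl fun i _ => ?_
    rw [Finset.mul_sum, Finset.mul_sum, ← Finset.sum_add_distrib]
    refine Finset.sum_congr rfl fun j _ => ?_
    split_ifs <;> ring
  have h3 : ∀ x : ℂ, ((‖x‖ ^ 2 : ℝ) : ℂ) = x * (starRingEnd ℂ) x := fun x => by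
    rw [Complex.mul_conj, Complex.normSq_eq_norm_sq]
  simp only [hχ]
  simp only [Complex.ofReal_sum, h3]
  -- The variance identity: deviations from the mean s/k lose |s|²/k.
  have h4 : ∑ a, (ψ a - s / k) * (starRingEnd ℂ) (ψ a - s / k) =
      ∑ a, ψ a * (starRingEnd ℂ) (ψ a) - s * (starRingEnd ℂ) s / k := by
    have h5 : ∀ a, (ψ a - s / k) * (starRingEnd ℂ) (ψ a - s / k) = ψ a * (starRingEnd ℂ) (ψ a) -
        ψ a * (starRingEnd ℂ) s / k - (starRingEnd ℂ) (ψ a) * s / k +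
          s * (starRingEnd ℂ) s / (k * k) := fun a => by
      rw [map_sub, map_div₀, Complex.conj_natCast]
      field_simp
      ring
    simp only [h5, Finset.sum_add_distrib, Finset.sum_sub_distrib, ← Finset.sum_div,
      ← Finset.sum_mul, ← map_sum, hψs, Finset.sum_const, Finset.card_univ, Fintype.card_fin,
      nsmul_eq_mul]
    field_simp
    ring
  rw [h1, h4]
  field_simp
  ring

/-! ### Counting the eigenvalues in the middle of the spectrum -/

/-- The squared distance from the matrix of edge probabilities to its truncated Fourier series. -/
def truncationError {d n k : ℕ} (F_in F_out : UnitAddTorus (Fin d) → ℝ) (σ : Fin n → Fin k)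
    (S : Finset (Fin d → ℤ)) (X : Fin n → UnitAddTorus (Fin d)) : ℝ :=
  ∑ i, ∑ j, ‖((if i = j then 0 else edgeProb F_in F_out σ X i j : ℝ) : ℂ) -
    partialFourier (blockFun F_in F_out (σ i) (σ j)) S (X i - X j)‖ ^ 2

/-- The limit of the normalized eigenvalues at frequency `z` on centered community vectors. -/
def contrastEigval {d : ℕ} (k : ℕ) (F_in F_out : UnitAddTorus (Fin d) → ℝ) (z : Fin d → ℤ) : ℂ :=
  (fourierCoeff F_in z - fourierCoeff F_out z) / k

/-- The limit of the normalized eigenvalues at frequency `z` on constant community vectors. -/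
def meanEigval {d : ℕ} (k : ℕ) (F_in F_out : UnitAddTorus (Fin d) → ℝ) (z : Fin d → ℤ) : ℂ :=
  (fourierCoeff F_in z + (k - 1) * fourierCoeff F_out z) / k

/-- The sum of the residuals of the approximate eigenvectors of frequency `z`. -/
def freqResidual {d n k : ℕ} (F_in F_out : UnitAddTorus (Fin d) → ℝ) (σ : Fin n → Fin k)
    (X : Fin n → UnitAddTorus (Fin d)) (G : SimpleGraph (Fin n)) (z : Fin d → ℤ) : ℝ :=
  ∑ a, residual G (n * contrastEigval k F_in F_out z) (modulated X σ z (centered a)) +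
    residual G (n * meanEigval k F_in F_out z) (modulated X σ z 1)

theorem freqResidual_nonneg {d n k : ℕ} (F_in F_out : UnitAddTorus (Fin d) → ℝ)
    (σ : Fin n → Fin k) (X : Fin n → UnitAddTorus (Fin d)) (G : SimpleGraph (Fin n))
    (z : Fin d → ℤ) : 0 ≤ freqResidual F_in F_out σ X G z :=
  add_nonneg (Finset.sum_nonneg fun _ _ => residual_nonneg _ _ _) (residual_nonneg _ _ _)

theorem adj_eq_noise_add {n : ℕ} (p : Fin n → Fin n → ℝ) (G : SimpleGraph (Fin n))
    (i j : Fin n) : adj G i j = noise p G i j + if i = j then 0 else p i j := by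
  classical
  unfold noise adj
  by_cases h : i = j
  · subst h
    simp
  · simp only [SimpleGraph.adjMatrix_apply, h, if_false]
    split_ifs <;> ring

/-- `λ = (μ_in - μ_out) / k`. -/
def target {d : ℕ} (k : ℕ) (F_in F_out : UnitAddTorus (Fin d) → ℝ) : ℝ :=
  (density F_in - density F_out) / k

theorem contrastEigval_zero {d : ℕ} (k : ℕ) (F_in F_out : UnitAddTorus (Fin d) → ℝ) :
    contrastEigval k F_in F_out 0 = (target k F_in F_out : ℂ) := by
  simp [contrastEigval, target, fourierCoeff_zero]

theorem edgeProb_symm {d n k : ℕ} {F_in F_out : UnitAddTorus (Fin d) → ℝ}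
    (hF_in : IsConnectivity F_in) (hF_out : IsConnectivity F_out) (σ : Fin n → Fin k)
    (X : Fin n → UnitAddTorus (Fin d)) (i j : Fin n) :
    edgeProb F_in F_out σ X i j = edgeProb F_in F_out σ X j i := by
  unfold edgeProb
  rw [← neg_sub (X j) (X i), hF_in.even, hF_out.even]
  simp only [eq_comm (a := σ i)]

theorem edgeProb_mem_Icc {d n k : ℕ} {F_in F_out : UnitAddTorus (Fin d) → ℝ}
    (hF_in : IsConnectivity F_in) (hF_out : IsConnectivity F_out) (σ : Fin n → Fin k)
    (X : Fin n → UnitAddTorus (Fin d)) (i j : Fin n) :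
    edgeProb F_in F_out σ X i j ∈ Set.Icc (0 : ℝ) 1 := by
  rw [edgeProb_eq]
  exact (blockFun_isConnectivity hF_in hF_out _ _).mem_Icc _

/-- The quadratic form of the truncated Fourier series. -/
theorem sum_quadratic_partialFourier {d n k : ℕ} (hk : k ≠ 0)
    (F_in F_out : UnitAddTorus (Fin d) → ℝ) (σ : Fin n → Fin k) (S : Finset (Fin d → ℤ))
    (X : Fin n → UnitAddTorus (Fin d)) (w : Fin n → ℝ) :
    ∑ i, ∑ j, (w i : ℂ) * partialFourier (blockFun F_in F_out (σ i) (σ j)) S (X i - X j) * w j =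
      ∑ z ∈ S, (k * contrastEigval k F_in F_out z *
          ∑ a, (‖∑ l, (w l : ℂ) * modulated X σ z (centered a) l‖ ^ 2 : ℝ) +
        meanEigval k F_in F_out z * (‖∑ l, (w l : ℂ) * modulated X σ z 1 l‖ ^ 2 : ℝ)) := by
  have hk' : (k : ℂ) ≠ 0 := Nat.cast_ne_zero.2 hk
  -- At a fixed frequency the kernel is a block constant times e_z(X_i) times the conjugate of
  -- e_z(X_j), so `sum_block_quadratic` applies to y_i = w_i e_z(X_i).
  have h1 : ∀ z ∈ S, (k * contrastEigval k F_in F_out z *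
          ∑ a, (‖∑ l, (w l : ℂ) * modulated X σ z (centered a) l‖ ^ 2 : ℝ) +
        meanEigval k F_in F_out z * (‖∑ l, (w l : ℂ) * modulated X σ z 1 l‖ ^ 2 : ℝ)) =
      ∑ i, ∑ j, (if σ i = σ j then fourierCoeff F_in z else fourierCoeff F_out z) *
        ((w i * UnitAddTorus.mFourier z (X i)) *
          (starRingEnd ℂ) (w j * UnitAddTorus.mFourier z (X j))) := fun z _ => by
    rw [sum_block_quadratic hk]
    rw [contrastEigval, mul_div_cancel₀ _ hk']
    simp only [modulated, meanEigval, Pi.one_apply, Complex.ofReal_one, mul_one, mul_assoc]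
  rw [Finset.sum_congr rfl h1]
  symm
  rw [Finset.sum_comm]
  refine Finset.sum_congr rfl fun i _ => ?_
  rw [Finset.sum_comm]
  refine Finset.sum_congr rfl fun j _ => ?_
  symm
  rw [partialFourier, Finset.mul_sum, Finset.sum_mul]
  refine Finset.sum_congr rfl fun z _ => ?_
  rw [sub_eq_add_neg, mFourier_apply_add, mFourier_apply_neg, map_mul, Complex.conj_ofReal]
  have : fourierCoeff (blockFun F_in F_out (σ i) (σ j)) z =
      if σ i = σ j then fourierCoeff F_in z else fourierCoeff F_out z := by
    unfold blockFun
    split_ifs <;> rfl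
  rw [this]
  ring

theorem norm_contrastEigval_le {d k : ℕ} {F_in F_out : UnitAddTorus (Fin d) → ℝ}
    (hF_in : IsConnectivity F_in) (hF_out : IsConnectivity F_out) (z : Fin d → ℤ) :
    ‖k * contrastEigval k F_in F_out z‖ ≤ 2 := by
  rcases eq_or_ne k 0 with rfl | hk
  · simp
  rw [contrastEigval, mul_div_cancel₀ _ (Nat.cast_ne_zero.2 hk)]
  exact (norm_sub_le _ _).trans
    (by linarith [norm_fourierCoeff_le hF_in z, norm_fourierCoeff_le hF_out z])

/-- This is a convex combination of two Fourier coefficients. The constant 2 is chosen to agree with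
`norm_contrastEigval_le`, so that `eigenvalue_le` can treat both kinds of terms alike. -/
theorem norm_meanEigval_le {d k : ℕ} (hk : 1 ≤ k) {F_in F_out : UnitAddTorus (Fin d) → ℝ}
    (hF_in : IsConnectivity F_in) (hF_out : IsConnectivity F_out) (z : Fin d → ℤ) :
    ‖meanEigval k F_in F_out z‖ ≤ 2 := by
  have hk' : (1 : ℝ) ≤ k := by exact_mod_cast hk
  have h1 : ‖((k : ℂ) - 1)‖ = k - 1 := by
    rw [← Complex.ofReal_natCast, ← Complex.ofReal_one, ← Complex.ofReal_sub, Complex.norm_real,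
      Real.norm_eq_abs, abs_of_nonneg (by linarith)]
  rw [meanEigval, norm_div, Complex.norm_natCast, div_le_iff₀ (by linarith)]
  refine (norm_add_le _ _).trans ?_
  rw [norm_mul, h1]
  have := norm_fourierCoeff_le hF_in z
  have := mul_le_mul_of_nonneg_left (norm_fourierCoeff_le hF_out z) (sub_nonneg.2 hk')
  linarith

/-- The upper bound for an eigenvalue close to the target value. -/
theorem eigenvalue_le {d n k : ℕ} (hk : 1 ≤ k) {F_in F_out : UnitAddTorus (Fin d) → ℝ}
    (hF_in : IsConnectivity F_in) (hF_out : IsConnectivity F_out) (σ : Fin n → Fin k)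
    (X : Fin n → UnitAddTorus (Fin d)) (G : SimpleGraph (Fin n)) {w : Fin n → ℝ} {Λ : ℝ}
    (hw : (adj G).mulVec w = Λ • w) (hw1 : ∑ i, w i ^ 2 = 1) {S : Finset (Fin d → ℤ)}
    (h0S : (0 : Fin d → ℤ) ∈ S) {ε : ℝ} (hε : 0 < ε) (hn : 0 < n)
    (hΛ : |Λ - n * target k F_in F_out| ≤ n * ε)
    (hmean : ∀ z ∈ S, 2 * ε ≤ ‖(target k F_in F_out : ℂ) - meanEigval k F_in F_out z‖)
    (hcontrast : ∀ z ∈ S, z ≠ 0 →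
      2 * ε ≤ ‖(target k F_in F_out : ℂ) - contrastEigval k F_in F_out z‖)
    {t s : ℝ} (ht : 0 ≤ t) (hs : 0 ≤ s)
    (hnoise : noiseSqNorm (edgeProb F_in F_out σ X) G ≤ t ^ 4)
    (htrunc : truncationError F_in F_out σ S X ≤ s ^ 2) :
    Λ ≤ t + s + k * target k F_in F_out * ∑ a, (∑ l, w l * centered a (σ l)) ^ 2 +
      2 * (∑ z ∈ S, freqResidual F_in F_out σ X G z) / (n * ε) ^ 2 := by
  set p := edgeProb F_in F_out σ X with hp
  set lam := target k F_in F_out with hlam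
  have hn' : (0 : ℝ) < n := Nat.cast_pos.2 hn
  have hδ : 0 < (n : ℝ) * ε := mul_pos hn' hε
  -- The eigenvalue is the Rayleigh quotient of w, to be split into noise, truncation error and
  -- truncated series.
  have hquad : Λ = ∑ i, ∑ j, w i * adj G i j * w j := by
    have h1 : ∀ i, ∑ j, adj G i j * w j = Λ * w i := fun i => by
      have := congrFun hw i
      simpa only [Matrix.mulVec, dotProduct, Pi.smul_apply, smul_eq_mul] using this
    have h2 : ∀ i, ∑ j, w i * adj G i j * w j = Λ * w i ^ 2 := fun i => by
      simp only [mul_assoc]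
      rw [← Finset.mul_sum, h1]
      ring
    simp only [h2]
    rw [← Finset.mul_sum, hw1, mul_one]
  have hN : ∑ i, ∑ j, w i * noise p G i j * w j ≤ t := by
    have h1 := quadratic_pow_four_le w hw1 (noise p G)
      (noise_symm (edgeProb_symm hF_in hF_out σ X) G)
    exact le_of_abs_le (by
      rw [← abs_of_nonneg ht]
      refine le_of_pow_le_pow_left₀ (n := 4) (by norm_num) (abs_nonneg _) ?_
      rw [Even.pow_abs (by decide), Even.pow_abs (by decide)]
      exact h1.trans hnoise)
  have hT : ‖∑ i, ∑ j, (w i : ℂ) * (((if i = j then 0 else p i j : ℝ) : ℂ) -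
      partialFourier (blockFun F_in F_out (σ i) (σ j)) S (X i - X j)) * w j‖ ≤ s := by
    refine le_of_pow_le_pow_left₀ (n := 2) (by norm_num) hs ?_
    exact (norm_quadratic_sq_le w hw1 _).trans htrunc
  -- Λ is within nε of nλ while nν is at least 2nε away, which leaves a gap nε.
  have hfar : ∀ ν : ℂ, 2 * ε ≤ ‖(lam : ℂ) - ν‖ → (n : ℝ) * ε ≤ ‖(Λ : ℂ) - n * ν‖ := by
    intro ν hν
    have h1 : (n : ℂ) * ((lam : ℂ) - ν) = (Λ - n * ν) - ((Λ - n * lam : ℝ) : ℂ) := by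
      push_cast
      ring
    have h2 := norm_sub_le ((Λ : ℂ) - n * ν) ((Λ - n * lam : ℝ) : ℂ)
    rw [← h1, norm_mul, Complex.norm_natCast, Complex.norm_real, Real.norm_eq_abs] at h2
    have h3 := mul_le_mul_of_nonneg_left hν hn'.le
    linarith
  have hQ : (∑ i, ∑ j, (w i : ℂ) * partialFourier (blockFun F_in F_out (σ i) (σ j)) S (X i - X j) *
      w j).re ≤ k * lam * ∑ a, (∑ l, w l * centered a (σ l)) ^ 2 +
        2 * (∑ z ∈ S, freqResidual F_in F_out σ X G z) / (n * ε) ^ 2 := by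
    rw [sum_quadratic_partialFourier (by omega), Complex.re_sum]
    -- Every term except the contrast term at frequency zero is absorbed into the residuals through
    -- almost orthogonality; the exceptional term is kept exactly.
    have hz : ∀ z ∈ S, (k * contrastEigval k F_in F_out z *
          ∑ a, (‖∑ l, (w l : ℂ) * modulated X σ z (centered a) l‖ ^ 2 : ℝ) +
        meanEigval k F_in F_out z * (‖∑ l, (w l : ℂ) * modulated X σ z 1 l‖ ^ 2 : ℝ)).re ≤
        (if z = 0 then k * lam * ∑ a, (∑ l, w l * centered a (σ l)) ^ 2 else 0) +
          2 * freqResidual F_in F_out σ X G z / (n * ε) ^ 2 := by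
      intro z hzS
      have hre : ∀ (c : ℂ) (x r : ℝ), ‖c‖ ≤ 2 → 0 ≤ x → x ≤ r / (n * ε) ^ 2 →
          (c * (x : ℂ)).re ≤ 2 * r / (n * ε) ^ 2 := by
        intro c x r hc hx hxr
        calc (c * (x : ℂ)).re ≤ ‖c * (x : ℂ)‖ := Complex.re_le_norm _
          _ = ‖c‖ * x := by rw [norm_mul, Complex.norm_real, Real.norm_eq_abs, abs_of_nonneg hx]
          _ ≤ 2 * (r / (n * ε) ^ 2) := mul_le_mul hc hxr hx (by norm_num)
          _ = _ := by ring
      have hm := hre _ _ _ (norm_meanEigval_le hk hF_in hF_out z) (sq_nonneg _)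
        (norm_sum_eigenvector_sq_le hw hw1 (modulated X σ z 1) hδ (hfar _ (hmean z hzS)))
      have hsplit : 2 * freqResidual F_in F_out σ X G z / (n * ε) ^ 2 =
          2 * (∑ a, residual G (n * contrastEigval k F_in F_out z)
            (modulated X σ z (centered a))) / (n * ε) ^ 2 +
          2 * residual G (n * meanEigval k F_in F_out z) (modulated X σ z 1) / (n * ε) ^ 2 := by
        rw [freqResidual]
        ring
      rw [Complex.add_re, hsplit]
      split_ifs with h
      · subst h
        have h1 : (k * contrastEigval k F_in F_out 0 *
            ∑ a, (‖∑ l, (w l : ℂ) * modulated X σ 0 (centered a) l‖ ^ 2 : ℝ)).re =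
              k * lam * ∑ a, (∑ l, w l * centered a (σ l)) ^ 2 := by
          rw [contrastEigval_zero]
          have h2 : ∀ a : Fin k, ‖∑ l, (w l : ℂ) * modulated X σ 0 (centered a) l‖ ^ 2 =
              (∑ l, w l * centered a (σ l)) ^ 2 := fun a => by
            have h3 : ∑ l, (w l : ℂ) * modulated X σ 0 (centered a) l =
                ((∑ l, w l * centered a (σ l) : ℝ) : ℂ) := by
              push_cast
              exact Finset.sum_congr rfl fun l _ => by
                simp [modulated, UnitAddTorus.mFourier_zero]
            rw [h3, Complex.norm_real, Real.norm_eq_abs, sq_abs]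
          simp only [h2]
          rw [← Complex.ofReal_natCast, ← Complex.ofReal_mul,
            ← Complex.ofReal_mul, Complex.ofReal_re]
        rw [h1]
        have h2 : 0 ≤ 2 * (∑ a, residual G (n * contrastEigval k F_in F_out 0)
            (modulated X σ 0 (centered a))) / (n * ε) ^ 2 :=
          div_nonneg (mul_nonneg (by norm_num)
            (Finset.sum_nonneg fun _ _ => residual_nonneg _ _ _)) (sq_nonneg _)
        linarith
      · have h1 := hre _ _ _ (norm_contrastEigval_le (k := k) hF_in hF_out z)
          (Finset.sum_nonneg (s := Finset.univ) fun (a : Fin k) _ => sq_nonneg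
            ‖∑ l, (w l : ℂ) * modulated X σ z (centered a) l‖)
          ((Finset.sum_le_sum (s := Finset.univ) fun (a : Fin k) _ => norm_sum_eigenvector_sq_le hw hw1
            (modulated X σ z (centered a)) hδ (hfar _ (hcontrast z hzS h))).trans
              (Finset.sum_div _ _ _).ge)
        linarith
    refine (Finset.sum_le_sum hz).trans (le_of_eq ?_)
    rw [Finset.sum_add_distrib, Finset.sum_ite_eq' S (0 : Fin d → ℤ), if_pos h0S,
      ← Finset.sum_div, ← Finset.mul_sum]
  have hsum : Λ = (∑ i, ∑ j, w i * noise p G i j * w j) +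
      (∑ i, ∑ j, (w i : ℂ) * (((if i = j then 0 else p i j : ℝ) : ℂ) -
        partialFourier (blockFun F_in F_out (σ i) (σ j)) S (X i - X j)) * w j).re +
      (∑ i, ∑ j, (w i : ℂ) * partialFourier (blockFun F_in F_out (σ i) (σ j)) S (X i - X j) *
        w j).re := by
    rw [add_assoc, ← Complex.add_re, ← Finset.sum_add_distrib]
    have h1 : ∀ i, (∑ j, (w i : ℂ) * (((if i = j then 0 else p i j : ℝ) : ℂ) -
        partialFourier (blockFun F_in F_out (σ i) (σ j)) S (X i - X j)) * w j) +
        (∑ j, (w i : ℂ) * partialFourier (blockFun F_in F_out (σ i) (σ j)) S (X i - X j) *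
          w j) = ((∑ j, w i * (if i = j then 0 else p i j) * w j : ℝ) : ℂ) := fun i => by
      rw [← Finset.sum_add_distrib, Complex.ofReal_sum]
      refine Finset.sum_congr rfl fun j _ => ?_
      rw [Complex.ofReal_mul, Complex.ofReal_mul]
      ring
    simp only [h1]
    rw [← Complex.ofReal_sum, Complex.ofReal_re, ← Finset.sum_add_distrib, hquad]
    refine Finset.sum_congr rfl fun i _ => ?_
    rw [← Finset.sum_add_distrib]
    refine Finset.sum_congr rfl fun j _ => ?_
    rw [adj_eq_noise_add p]
    ring
  have hT' := (Complex.re_le_norm _).trans hT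
  linarith

theorem sum_comp_eq_of_isBalanced {n k : ℕ} (hk : k ≠ 0) {σ : Fin n → Fin k} (hσ : IsBalanced σ)
    {M : Type*} [Field M] [CharZero M] (f : Fin k → M) :
    ∑ l, f (σ l) = n / k * ∑ b, f b := by
  have hk' : (k : M) ≠ 0 := Nat.cast_ne_zero.2 hk
  rw [← Finset.sum_fiberwise (s := Finset.univ) (g := σ), Finset.mul_sum]
  refine Finset.sum_congr rfl fun b _ => ?_
  have h1 : ((Finset.univ.filter fun i => σ i = b).card : M) = n / k := by
    rw [eq_div_iff hk', mul_comm]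
    exact_mod_cast hσ b
  rw [Finset.sum_congr rfl fun i hi => by rw [(Finset.mem_filter.1 hi).2], Finset.sum_const,
    nsmul_eq_mul, h1]

theorem sum_centered {k : ℕ} (hk : k ≠ 0) (a : Fin k) : ∑ b, centered a b = 0 := by
  have hk' : (k : ℝ) ≠ 0 := Nat.cast_ne_zero.2 hk
  simp [centered, Finset.sum_sub_distrib, hk']

theorem sum_centered_sq {k : ℕ} (hk : k ≠ 0) (a : Fin k) :
    ∑ b, centered a b ^ 2 = 1 - (k : ℝ)⁻¹ := by
  have hk' : (k : ℝ) ≠ 0 := Nat.cast_ne_zero.2 hk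
  have h1 : ∀ b : Fin k, centered a b ^ 2 =
      (if b = a then 1 - 2 * (k : ℝ)⁻¹ else 0) + (k : ℝ)⁻¹ ^ 2 := fun b => by
    unfold centered
    split_ifs <;> ring
  simp only [h1, Finset.sum_add_distrib, Finset.sum_ite_eq', Finset.mem_univ, if_true,
    Finset.sum_const, Finset.card_univ, Fintype.card_fin, nsmul_eq_mul]
  field_simp
  ring

/-- At most `k - 1` eigenvalues are close to the target value when the noise, the truncation error
and the residuals are small. -/
theorem card_near_lt {d n k : ℕ} (hk : 1 ≤ k) {F_in F_out : UnitAddTorus (Fin d) → ℝ}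
    (hF_in : IsConnectivity F_in) (hF_out : IsConnectivity F_out) {σ : Fin n → Fin k}
    (hσ : IsBalanced σ) (X : Fin n → UnitAddTorus (Fin d)) (G : SimpleGraph (Fin n))
    {S : Finset (Fin d → ℤ)} (h0S : (0 : Fin d → ℤ) ∈ S) {ε : ℝ} (hε : 0 < ε) (hn : 0 < n)
    (htarget : 0 < target k F_in F_out)
    (hmean : ∀ z ∈ S, 2 * ε ≤ ‖(target k F_in F_out : ℂ) - meanEigval k F_in F_out z‖)
    (hcontrast : ∀ z ∈ S, z ≠ 0 →
      2 * ε ≤ ‖(target k F_in F_out : ℂ) - contrastEigval k F_in F_out z‖)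
    {t s r : ℝ} (ht : 0 ≤ t) (hs : 0 ≤ s)
    (hnoise : noiseSqNorm (edgeProb F_in F_out σ X) G ≤ (n * t) ^ 4)
    (htrunc : truncationError F_in F_out σ S X ≤ (n * s) ^ 2)
    (hres : ∑ z ∈ S, freqResidual F_in F_out σ X G z ≤ n ^ 3 * r)
    (hsmall : k * (ε + t + s + 2 * r / ε ^ 2) < target k F_in F_out) :
    (Finset.univ.filter fun i => |eigval G i - n * target k F_in F_out| < n * ε).card < k := by
  by_contra hcon
  -- With k near eigenvalues, their sum is estimated from both sides.
  obtain ⟨J, hJ, hJk⟩ := Finset.exists_subset_card_eq (not_lt.1 hcon)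
  set lam := target k F_in F_out with hlam
  have hn' : (0 : ℝ) < n := Nat.cast_pos.2 hn
  have hk0 : (0 : ℝ) < k := Nat.cast_pos.2 hk
  have hnear : ∀ i ∈ J, |eigval G i - n * lam| < n * ε := fun i hi =>
    (Finset.mem_filter.1 (hJ hi)).2
  have hlow : (k : ℝ) * (n * lam - n * ε) ≤ ∑ i ∈ J, eigval G i := by
    have h1 : ∑ _i ∈ J, ((n : ℝ) * lam - n * ε) ≤ ∑ i ∈ J, eigval G i :=
      Finset.sum_le_sum fun i hi => by linarith [(abs_lt.1 (hnear i hi)).1]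
    rwa [Finset.sum_const, hJk, nsmul_eq_mul] at h1
  have hup : ∑ i ∈ J, eigval G i ≤ ∑ i ∈ J, (n * t + n * s + k * lam *
      ∑ a, (∑ l, eigvec G i l * centered a (σ l)) ^ 2 + 2 * (n ^ 3 * r) / (n * ε) ^ 2) := by
    refine Finset.sum_le_sum fun i hi => ?_
    refine (eigenvalue_le hk hF_in hF_out σ X G (mulVec_eigvec G i) (sum_eigvec_sq G i) h0S hε hn
      (hnear i hi).le hmean hcontrast (by positivity) (by positivity) hnoise htrunc).trans ?_
    gcongr
  -- Bessel for each χ_a, followed by Σ_a ‖χ_a‖² = n(1 − 1/k).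
  have hbessel : ∑ i ∈ J, ∑ a, (∑ l, eigvec G i l * centered a (σ l)) ^ 2 ≤ n * (1 - (k : ℝ)⁻¹) := by
    rw [Finset.sum_comm]
    calc ∑ a, ∑ i ∈ J, (∑ l, eigvec G i l * centered a (σ l)) ^ 2
        ≤ ∑ a : Fin k, ∑ l, centered a (σ l) ^ 2 :=
          Finset.sum_le_sum fun a _ => sum_eigvec_mul_sq_le G J fun l => centered a (σ l)
      _ = ∑ a : Fin k, (n / k * (1 - (k : ℝ)⁻¹)) := by
          refine Finset.sum_congr rfl fun a _ => ?_
          rw [sum_comp_eq_of_isBalanced (by omega) hσ fun b => centered a b ^ 2,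
            sum_centered_sq (by omega)]
      _ = n * (1 - (k : ℝ)⁻¹) := by
          simp only [Finset.sum_const, Finset.card_univ, Fintype.card_fin, nsmul_eq_mul]
          field_simp
  simp only [Finset.sum_add_distrib, ← Finset.mul_sum, Finset.sum_const, hJk, nsmul_eq_mul] at hup
  have h1 := mul_le_mul_of_nonneg_left hbessel (mul_pos hk0 htarget).le
  -- The upper bound has main term (k − 1)λn, one λn short of the lower bound; `hsmall` says that
  -- the error terms cannot fill this gap.
  have h2 : k * lam * (n * (1 - (k : ℝ)⁻¹)) = n * (k * lam - lam) := by field_simp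
  have h3 : 2 * ((n : ℝ) ^ 3 * r) / (n * ε) ^ 2 = n * (2 * r / ε ^ 2) := by field_simp
  rw [h3] at hup
  have h4 := mul_lt_mul_of_pos_left hsmall hn'
  linarith

/-! ### From the labels of most vertices to the absolute error -/

/-- Every community is larger than B, so it has a representative outside B. Representatives of
different communities have different labels, so their labels exhaust all k values, and undoing this
permutation makes τ agree with σ outside B. -/
theorem absError_le_card {n k : ℕ} {σ τ : Fin n → Fin k} (hσ : IsBalanced σ)
    (B : Finset (Fin n)) (hB : ∀ i ∉ B, ∀ j ∉ B, τ i = τ j → σ i = σ j) (hcard : k * B.card < n) :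
    absError σ τ ≤ B.card := by
  have hrep : ∀ a, ∃ i, i ∉ B ∧ σ i = a := by
    intro a
    by_contra hcon
    push Not at hcon
    have hsub : (Finset.univ.filter fun i => σ i = a) ⊆ B := fun i hi => by
      by_contra hiB
      exact hcon i hiB (Finset.mem_filter.1 hi).2
    have h1 := Nat.mul_le_mul_left k (Finset.card_le_card hsub)
    rw [hσ a] at h1
    omega
  choose rep hrepB hrepσ using hrep
  have hinj : Function.Injective fun a => τ (rep a) := fun a b hab => by
    rw [← hrepσ a, ← hrepσ b]
    exact hB _ (hrepB a) _ (hrepB b) hab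
  set e : Fin k ≃ Fin k := Equiv.ofBijective _ (Finite.injective_iff_bijective.1 hinj)
  have he : ∀ a, e a = τ (rep a) := fun _ => rfl
  have hmem : hammingDist σ (e.symm ∘ τ) ∈ {m : ℕ | ∃ τ' : Fin n → Fin k,
      (∀ i j, τ' i = τ' j ↔ τ i = τ j) ∧ m = hammingDist σ τ'} :=
    ⟨e.symm ∘ τ, fun i j => e.symm.injective.eq_iff, rfl⟩
  refine (Nat.sInf_le hmem).trans ?_
  unfold hammingDist
  refine Finset.card_le_card fun i hi => ?_
  by_contra hiB
  refine (Finset.mem_filter.1 hi).2 ?_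
  have h1 : τ (rep (e.symm (τ i))) = τ i := by rw [← he, Equiv.apply_symm_apply]
  have h2 := hB _ (hrepB _) _ hiB h1
  rw [hrepσ] at h2
  exact h2.symm

/-- By Markov's inequality at most 4κ/D vertices have a fitted center at squared distance D/4 or
more from the ideal one. Two other vertices with a common label have ideal centers at squared
distance less than D, hence lie in the same community. -/
theorem absError_le_of_centers {n k r : ℕ} {σ τ : Fin n → Fin k} (hσ : IsBalanced σ)
    (Y θ : Fin k → Fin r → ℝ) {D κ : ℝ} (hD : 0 < D)
    (hsep : ∀ a b, a ≠ b → D ≤ ∑ j, (θ a j - θ b j) ^ 2)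
    (hκ : ∑ i, ∑ j, (Y (τ i) j - θ (σ i) j) ^ 2 ≤ κ) (hsmall : k * (4 * κ / D) < n) :
    (absError σ τ : ℝ) ≤ 4 * κ / D := by
  set B : Finset (Fin n) :=
    Finset.univ.filter fun i => D / 4 ≤ ∑ j, (Y (τ i) j - θ (σ i) j) ^ 2 with hBdef
  have hcard : (B.card : ℝ) ≤ 4 * κ / D := by
    have h1 : ∑ _i ∈ B, D / 4 ≤ ∑ i ∈ B, ∑ j, (Y (τ i) j - θ (σ i) j) ^ 2 :=
      Finset.sum_le_sum fun i hi => (Finset.mem_filter.1 hi).2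
    have h2 : ∑ i ∈ B, ∑ j, (Y (τ i) j - θ (σ i) j) ^ 2 ≤
        ∑ i, ∑ j, (Y (τ i) j - θ (σ i) j) ^ 2 :=
      Finset.sum_le_sum_of_subset_of_nonneg (Finset.subset_univ _)
        fun _ _ _ => Finset.sum_nonneg fun _ _ => sq_nonneg _
    rw [Finset.sum_const, nsmul_eq_mul] at h1
    rw [le_div_iff₀ hD]
    linarith
  have hB : ∀ i ∉ B, ∀ j ∉ B, τ i = τ j → σ i = σ j := by
    intro i hi j hj hij
    by_contra hne
    have h1 : ∑ q, (Y (τ i) q - θ (σ i) q) ^ 2 < D / 4 := by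
      by_contra h
      exact hi (Finset.mem_filter.2 ⟨Finset.mem_univ _, not_lt.1 h⟩)
    have h2 : ∑ q, (Y (τ j) q - θ (σ j) q) ^ 2 < D / 4 := by
      by_contra h
      exact hj (Finset.mem_filter.2 ⟨Finset.mem_univ _, not_lt.1 h⟩)
    have h3 : ∑ q, (θ (σ i) q - θ (σ j) q) ^ 2 ≤
        2 * ∑ q, (Y (τ i) q - θ (σ i) q) ^ 2 + 2 * ∑ q, (Y (τ j) q - θ (σ j) q) ^ 2 := by
      rw [Finset.mul_sum, Finset.mul_sum, ← Finset.sum_add_distrib, hij]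
      refine Finset.sum_le_sum fun q _ => ?_
      linarith [sq_nonneg ((Y (τ j) q - θ (σ i) q) + (Y (τ j) q - θ (σ j) q))]
    linarith [hsep _ _ hne]
  have h1 : (k : ℝ) * B.card < n :=
    (mul_le_mul_of_nonneg_left hcard (Nat.cast_nonneg k)).trans_lt hsmall
  have h2 := absError_le_card hσ B hB (by exact_mod_cast h1)
  exact le_trans (by exact_mod_cast h2) hcard

/-! ### The span of the chosen eigenvectors -/

open Matrix in
/-- The squared distance from `u` to the span of the orthonormal columns of `V`. -/
theorem residual_dotProduct {n r : ℕ} {V : Matrix (Fin n) (Fin r) ℝ} (hV : Vᵀ * V = 1)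
    (u : Fin n → ℝ) :
    ((1 - V * Vᵀ) *ᵥ u) ⬝ᵥ ((1 - V * Vᵀ) *ᵥ u) = u ⬝ᵥ u - (Vᵀ *ᵥ u) ⬝ᵥ (Vᵀ *ᵥ u) := by
  have h1 : (1 - V * Vᵀ)ᵀ * (1 - V * Vᵀ) = 1 - V * Vᵀ := by
    have h2 : V * Vᵀ * (V * Vᵀ) = V * Vᵀ := by
      rw [Matrix.mul_assoc V Vᵀ, ← Matrix.mul_assoc Vᵀ V, hV, Matrix.one_mul]
    rw [transpose_sub, transpose_mul, transpose_transpose, transpose_one, Matrix.sub_mul,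
      Matrix.mul_sub, Matrix.mul_sub, h2]
    simp
  rw [dotProduct_mulVec, vecMul_mulVec, ← dotProduct_mulVec, h1]
  rw [sub_mulVec, one_mulVec, dotProduct_sub, ← mulVec_mulVec, dotProduct_mulVec u V]
  rw [← mulVec_transpose]

open Matrix in
theorem eigvec_dotProduct {n : ℕ} (G : SimpleGraph (Fin n)) (i j : Fin n) :
    eigvec G i ⬝ᵥ eigvec G j = if i = j then 1 else 0 := by
  have h := orthonormal_iff_ite.1 (adj_isHermitian G).eigenvectorBasis.orthonormal i j
  rw [← h]
  simp [eigvec, PiLp.inner_apply, dotProduct, mul_comm]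

open Matrix in
theorem dotProduct_eq_zero_of_eigenvalue_ne {n : ℕ} {G : SimpleGraph (Fin n)} {v w : Fin n → ℝ}
    {a b : ℝ} (hv : (adj G).mulVec v = a • v) (hw : (adj G).mulVec w = b • w) (hab : a ≠ b) :
    v ⬝ᵥ w = 0 := by
  have h1 : v ⬝ᵥ (adj G *ᵥ w) = (adj G *ᵥ v) ⬝ᵥ w := by
    rw [dotProduct_mulVec, ← mulVec_transpose]
    congr 2
    ext i j
    exact adj_symm G j i
  rw [hv, hw, dotProduct_smul, smul_dotProduct, smul_eq_mul, smul_eq_mul] at h1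
  have h2 : (b - a) * (v ⬝ᵥ w) = 0 := by linarith
  exact (mul_eq_zero.1 h2).resolve_left (sub_ne_zero.2 hab.symm)

open Matrix in
theorem sum_eigvec_dotProduct_sq {n : ℕ} (G : SimpleGraph (Fin n)) (u : Fin n → ℝ) :
    ∑ i, (eigvec G i ⬝ᵥ u) ^ 2 = u ⬝ᵥ u := by
  simpa only [dotProduct, sq] using sum_eigvec_mul_sq G u

open Matrix in
/-- The chosen eigenvectors span all the eigenvectors whose eigenvalues are close to `c`. -/
theorem eigvec_mem_span {n r : ℕ} {G : SimpleGraph (Fin n)} {c δ : ℝ}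
    {V : Matrix (Fin n) (Fin r) ℝ} (hV : IsClosestEigenvectors G c V)
    (hcard : (Finset.univ.filter fun i => |eigval G i - c| < δ).card < r + 1) {i : Fin n}
    (hi : |eigval G i - c| < δ) : (1 - V * Vᵀ) *ᵥ eigvec G i = 0 := by
  obtain ⟨ι, hclose, -, hVV, hVe⟩ := hV
  set J : Finset (Fin n) := Finset.univ.filter fun i => |eigval G i - c| < δ with hJdef
  have hJ : ∀ i, i ∈ J ↔ |eigval G i - c| < δ := fun i => by simp [hJdef]
  -- If a near eigenvalue were left out, the r chosen ones would be at least as near, giving r + 1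
  -- near eigenvalues.
  have hrange : ∀ i ∈ J, i ∈ Set.range ι := by
    intro i hi
    by_contra hcon
    have hsub : insert i (Finset.univ.map ι) ⊆ J := by
      intro l hl
      rcases Finset.mem_insert.1 hl with rfl | hl
      · exact hi
      · obtain ⟨j, -, rfl⟩ := Finset.mem_map.1 hl
        exact (hJ _).2 ((hclose j i hcon).trans_lt ((hJ i).1 hi))
    have h1 := Finset.card_le_card hsub
    rw [Finset.card_insert_of_notMem (fun h => hcon (by
      obtain ⟨j, -, hj⟩ := Finset.mem_map.1 h
      exact ⟨j, hj⟩)), Finset.card_map, Finset.card_univ, Fintype.card_fin] at h1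
    omega
  set col : Fin r → Fin n → ℝ := fun j l => V l j with hcol
  have hVt : ∀ u, (Vᵀ *ᵥ u) ⬝ᵥ (Vᵀ *ᵥ u) = ∑ j, (col j ⬝ᵥ u) ^ 2 := fun u => by
    simp only [dotProduct, mulVec, hcol, transpose_apply, sq]
  have hunit : ∀ j, col j ⬝ᵥ col j = 1 := fun j => by
    have := congrFun (congrFun hVV j) j
    simpa [Matrix.mul_apply, dotProduct, hcol] using this
  have hle : ∀ i, ∑ j, (col j ⬝ᵥ eigvec G i) ^ 2 ≤ 1 := fun i => by
    have h1 := residual_dotProduct hVV (eigvec G i)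
    rw [hVt, eigvec_dotProduct, if_pos rfl] at h1
    have h2 : 0 ≤ ((1 - V * Vᵀ) *ᵥ eigvec G i) ⬝ᵥ ((1 - V * Vᵀ) *ᵥ eigvec G i) :=
      Finset.sum_nonneg fun _ _ => mul_self_nonneg _
    linarith
  -- The column need not belong to the eigenvector basis, but it is orthogonal to the basis vectors
  -- with far eigenvalues, so all its mass lies on J.
  have hnear : ∀ j, ι j ∈ J → ∑ i ∈ J, (col j ⬝ᵥ eigvec G i) ^ 2 = 1 := by
    intro j hj
    rw [← hunit j, ← sum_eigvec_dotProduct_sq G]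
    simp only [dotProduct_comm (col j)]
    refine Finset.sum_subset (Finset.subset_univ _) fun i _ hiJ => ?_
    rw [dotProduct_eq_zero_of_eigenvalue_ne (mulVec_eigvec G i) (hVe j), sq, zero_mul]
    intro heq
    rw [hJ] at hj hiJ
    rw [heq] at hiJ
    exact hiJ hj
  -- The columns with near eigenvalues are as many as J. The total mass is thus at least |J|, while
  -- each element of J receives at most 1, so each receives exactly 1.
  have hsum : (J.card : ℝ) ≤ ∑ i ∈ J, ∑ j, (col j ⬝ᵥ eigvec G i) ^ 2 := by
    rw [Finset.sum_comm]
    have h1 : (J.card : ℝ) = ∑ j ∈ Finset.univ.filter (fun j => ι j ∈ J),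
        ∑ i ∈ J, (col j ⬝ᵥ eigvec G i) ^ 2 := by
      rw [Finset.sum_congr rfl fun j hj => hnear j (Finset.mem_filter.1 hj).2]
      rw [Finset.sum_const, nsmul_eq_mul, mul_one, ← Finset.card_map ι]
      congr 2
      ext i
      simp only [Finset.mem_map, Finset.mem_filter, Finset.mem_univ, true_and]
      constructor
      · intro h
        obtain ⟨j, rfl⟩ := hrange i h
        exact ⟨j, h, rfl⟩
      · rintro ⟨j, h, rfl⟩
        exact h
    rw [h1]
    exact Finset.sum_le_sum_of_subset_of_nonneg (Finset.subset_univ _)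
      fun _ _ _ => Finset.sum_nonneg fun _ _ => sq_nonneg _
  have hone : ∑ j, (col j ⬝ᵥ eigvec G i) ^ 2 = 1 := by
    refine le_antisymm (hle i) ?_
    by_contra hlt
    have h1 : ∑ i ∈ J, ∑ j, (col j ⬝ᵥ eigvec G i) ^ 2 < ∑ _i ∈ J, (1 : ℝ) :=
      Finset.sum_lt_sum (fun i _ => hle i) ⟨i, (hJ i).2 hi, not_le.1 hlt⟩
    rw [Finset.sum_const, nsmul_eq_mul, mul_one] at h1
    linarith
  have h1 := residual_dotProduct hVV (eigvec G i)
  rw [hVt, hone, eigvec_dotProduct, if_pos rfl, sub_self] at h1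
  exact dotProduct_self_eq_zero.1 h1

open Matrix in
/-- An approximate eigenvector is close to the span of the chosen eigenvectors. -/
theorem residual_projection_le {n r : ℕ} {G : SimpleGraph (Fin n)} {c δ : ℝ} (hδ : 0 < δ)
    {V : Matrix (Fin n) (Fin r) ℝ} (hV : IsClosestEigenvectors G c V)
    (hcard : (Finset.univ.filter fun i => |eigval G i - c| < δ).card < r + 1) (u : Fin n → ℝ) :
    u ⬝ᵥ u - (Vᵀ *ᵥ u) ⬝ᵥ (Vᵀ *ᵥ u) ≤
      ((adj G *ᵥ u - c • u) ⬝ᵥ (adj G *ᵥ u - c • u)) / δ ^ 2 := by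
  have hVV : Vᵀ * V = 1 := by
    obtain ⟨ι, -, -, hVV, -⟩ := hV
    exact hVV
  set J : Finset (Fin n) := Finset.univ.filter fun i => |eigval G i - c| < δ with hJdef
  -- Removing the near components does not change the distance to the span, and each remaining
  -- component is amplified by at least δ under A − c.
  set y : Fin n → ℝ := u - ∑ i ∈ J, (eigvec G i ⬝ᵥ u) • eigvec G i with hy
  have hry : (1 - V * Vᵀ) *ᵥ u = (1 - V * Vᵀ) *ᵥ y := by
    rw [hy, mulVec_sub, mulVec_sum, Finset.sum_eq_zero, sub_zero]
    intro i hi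
    rw [mulVec_smul, eigvec_mem_span hV hcard (Finset.mem_filter.1 hi).2, smul_zero]
  have hyw : ∀ i, eigvec G i ⬝ᵥ y = if i ∈ J then 0 else eigvec G i ⬝ᵥ u := fun i => by
    rw [hy, dotProduct_sub, dotProduct_sum]
    simp only [dotProduct_smul, eigvec_dotProduct, smul_eq_mul, mul_ite, mul_one, mul_zero,
      Finset.sum_ite_eq]
    split_ifs <;> simp
  have hAu : ∀ i, eigvec G i ⬝ᵥ (adj G *ᵥ u - c • u) = (eigval G i - c) * (eigvec G i ⬝ᵥ u) := by
    intro i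
    have h1 : eigvec G i ⬝ᵥ (adj G *ᵥ u) = (adj G *ᵥ eigvec G i) ⬝ᵥ u := by
      rw [dotProduct_mulVec, ← mulVec_transpose]
      congr 2
      ext i j
      exact adj_symm G j i
    rw [dotProduct_sub, h1, mulVec_eigvec, smul_dotProduct, dotProduct_smul, smul_eq_mul,
      smul_eq_mul, sub_mul]
  rw [← residual_dotProduct hVV, hry, residual_dotProduct hVV, le_div_iff₀ (pow_pos hδ 2)]
  have h0 : 0 ≤ (Vᵀ *ᵥ y) ⬝ᵥ (Vᵀ *ᵥ y) := Finset.sum_nonneg fun _ _ => mul_self_nonneg _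
  refine (mul_le_mul_of_nonneg_right (sub_le_self _ h0) (sq_nonneg δ)).trans ?_
  rw [← sum_eigvec_dotProduct_sq G y, ← sum_eigvec_dotProduct_sq G (adj G *ᵥ u - c • u),
    Finset.sum_mul]
  refine Finset.sum_le_sum fun i _ => ?_
  rw [hyw, hAu]
  split_ifs with h
  · simpa using sq_nonneg ((eigval G i - c) * (eigvec G i ⬝ᵥ u))
  · have h1 : δ ≤ |eigval G i - c| := by
      by_contra hlt
      exact h (Finset.mem_filter.2 ⟨Finset.mem_univ _, not_le.1 hlt⟩)
    rw [mul_pow, mul_comm, ← sq_abs (eigval G i - c)]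
    gcongr

/-! ### Spectral clustering -/

/-- Pythagoras: the fitted vector is the orthogonal projection of v onto the mean-zero functions of
the community. -/
theorem sum_sub_sq_eq {n k : ℕ} (hk : k ≠ 0) (hn : n ≠ 0) {σ : Fin n → Fin k}
    (hσ : IsBalanced σ) (v : Fin n → ℝ) :
    ∑ i, ((k / n : ℝ) * (∑ l, centered (σ i) (σ l) * v l) - v i) ^ 2 =
      ∑ i, v i ^ 2 - (k / n : ℝ) * ∑ a, (∑ l, centered a (σ l) * v l) ^ 2 := by
  have hk' : (k : ℝ) ≠ 0 := Nat.cast_ne_zero.2 hk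
  have hn' : (n : ℝ) ≠ 0 := Nat.cast_ne_zero.2 hn
  set m : Fin k → ℝ := fun a => ∑ l, centered a (σ l) * v l with hm
  -- This kills the −1/k part of `centered` in the next identity.
  have hm0 : ∑ a, m a = 0 := by
    rw [hm, Finset.sum_comm]
    refine Finset.sum_eq_zero fun l _ => ?_
    rw [← Finset.sum_mul]
    have : ∑ a, centered a (σ l) = ∑ a, centered (σ l) a :=
      Finset.sum_congr rfl fun a _ => by simp [centered, eq_comm]
    rw [this, sum_centered hk, zero_mul]
  have h1 : ∑ i, m (σ i) * v i = ∑ a, m a ^ 2 := by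
    have h2 : ∀ i, m (σ i) * v i = ∑ a, m a * (centered a (σ i) * v i) := fun i => by
      have h3 : ∀ a, m a * (centered a (σ i) * v i) =
          (if σ i = a then m a * v i else 0) - m a * ((k : ℝ)⁻¹ * v i) := fun a => by
        unfold centered
        split_ifs <;> ring
      simp only [h3, Finset.sum_sub_distrib, ← Finset.sum_mul, hm0]
      simp
    simp only [h2]
    rw [Finset.sum_comm]
    refine Finset.sum_congr rfl fun a _ => ?_
    rw [← Finset.mul_sum, sq]
  have h4 := sum_comp_eq_of_isBalanced hk hσ fun a => m a ^ 2
  have h5 : ∀ i, ((k / n : ℝ) * m (σ i) - v i) ^ 2 =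
      (k / n : ℝ) ^ 2 * m (σ i) ^ 2 - 2 * (k / n : ℝ) * (m (σ i) * v i) + v i ^ 2 := fun i => by
    ring
  change ∑ i, ((k / n : ℝ) * m (σ i) - v i) ^ 2 = _
  simp only [h5, Finset.sum_add_distrib, Finset.sum_sub_distrib, ← Finset.mul_sum, h1, h4]
  field_simp
  ring

theorem membership_mul_apply {n k r : ℕ} (τ : Fin n → Fin k) (Y : Matrix (Fin k) (Fin r) ℝ)
    (i : Fin n) (j : Fin r) : (membership τ * Y) i j = Y (τ i) j := by
  simp [membership, Matrix.mul_apply]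

open Matrix in
/-- The squared norm of `(A - c) χ_a`, summed over the communities `a`. -/
def communityResidual {n k : ℕ} (σ : Fin n → Fin k) (G : SimpleGraph (Fin n)) (c : ℝ) : ℝ :=
  ∑ a, (adj G *ᵥ (fun l => centered a (σ l)) - c • fun l => centered a (σ l)) ⬝ᵥ
    (adj G *ᵥ (fun l => centered a (σ l)) - c • fun l => centered a (σ l))

-- Since the χ_a span a space of dimension k − 1, the same as the number of columns, closeness of
-- the χ_a to the column span gives the converse closeness: the rows of V are almost constant on
-- communities.
open Matrix in
theorem absError_le {n k : ℕ} (hk : 2 ≤ k) (hn : 0 < n) {σ τ : Fin n → Fin k}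
    (hσ : IsBalanced σ) {G : SimpleGraph (Fin n)} {c δ η ρ : ℝ} (hδ : 0 < δ) (hη : 0 < η)
    {V : Matrix (Fin n) (Fin (k - 1)) ℝ} (hV : IsClosestEigenvectors G c V)
    (hcard : (Finset.univ.filter fun i => |eigval G i - c| < δ).card < k)
    (hτ : IsApproxKMeans η V τ) (hρ : communityResidual σ G c / δ ^ 2 ≤ ρ)
    (hsmall : k * (8 * (2 + η) * ρ) < n) :
    (absError σ τ : ℝ) ≤ 8 * (2 + η) * ρ := by
  have hk0 : k ≠ 0 := by omega
  have hk' : (0 : ℝ) < k := Nat.cast_pos.2 (by omega)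
  have hn' : (0 : ℝ) < n := Nat.cast_pos.2 hn
  have hVV : Vᵀ * V = 1 := by
    obtain ⟨ι, -, -, hVV, -⟩ := hV
    exact hVV
  set χ : Fin k → Fin n → ℝ := fun a l => centered a (σ l) with hχ
  have hcard' : (Finset.univ.filter fun i => |eigval G i - c| < δ).card < k - 1 + 1 := by omega
  have hproj := residual_projection_le hδ hV hcard'
  set m : Fin k → Fin (k - 1) → ℝ := fun a => Vᵀ *ᵥ χ a with hm
  have hmj : ∀ a j, m a j = ∑ l, centered a (σ l) * V l j := fun a j => by
    simp only [hm, hχ, mulVec, dotProduct, transpose_apply, mul_comm]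
  have hχn : ∀ a, χ a ⬝ᵥ χ a = n / k * (1 - (k : ℝ)⁻¹) := fun a => by
    have := sum_comp_eq_of_isBalanced hk0 hσ fun b => centered a b ^ 2
    rw [sum_centered_sq hk0] at this
    simpa only [dotProduct, hχ, sq] using this
  have hdef : ∑ a, (χ a ⬝ᵥ χ a - m a ⬝ᵥ m a) ≤ ρ := by
    refine (Finset.sum_le_sum fun a _ => hproj (χ a)).trans ?_
    rw [← Finset.sum_div]
    exact hρ
  have hdef0 : ∀ u : Fin n → ℝ, 0 ≤ u ⬝ᵥ u - (Vᵀ *ᵥ u) ⬝ᵥ (Vᵀ *ᵥ u) := fun u => by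
    rw [← residual_dotProduct hVV]
    exact Finset.sum_nonneg fun _ _ => mul_self_nonneg _
  -- The ideal centers: row a is the average of the rows of V over community a, minus their global
  -- average.
  set θ : Matrix (Fin k) (Fin (k - 1)) ℝ := fun a j => (k / n : ℝ) * m a j with hθ
  have hideal : ∑ i, ∑ j, (θ (σ i) j - V i j) ^ 2 ≤ k / n * ρ := by
    rw [Finset.sum_comm]
    have hcolumn : ∀ j, ∑ i, (θ (σ i) j - V i j) ^ 2 =
        1 - (k / n : ℝ) * ∑ a, m a j ^ 2 := fun j => by
      have h1 := sum_sub_sq_eq hk0 hn.ne' hσ fun l => V l j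
      have h2 : ∑ i, V i j ^ 2 = 1 := by
        have := congrFun (congrFun hVV j) j
        simpa [Matrix.mul_apply, sq] using this
      rw [h2] at h1
      simpa only [hθ, hmj] using h1
    simp only [hcolumn, Finset.sum_sub_distrib, ← Finset.mul_sum]
    rw [Finset.sum_comm]
    simp only [Finset.sum_const, Finset.card_univ, Fintype.card_fin, nsmul_eq_mul, mul_one]
    have h1 : ∑ a, ∑ j, m a j ^ 2 = ∑ a, m a ⬝ᵥ m a := by simp only [dotProduct, sq]
    -- The squared norm k − 1 of V equals (k/n) Σ_a ‖χ_a‖². The cost of the ideal clustering is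
    -- therefore k/n times the total defect of the projected χ_a.
    have h2 : ((k - 1 : ℕ) : ℝ) = k / n * ∑ a, χ a ⬝ᵥ χ a := by
      simp only [hχn, Finset.sum_const, Finset.card_univ, Fintype.card_fin, nsmul_eq_mul]
      rw [Nat.cast_sub (by omega)]
      field_simp
      simp
    rw [h1, h2, ← mul_sub, ← Finset.sum_sub_distrib]
    exact mul_le_mul_of_nonneg_left hdef (by positivity)
  have hρ0 : 0 ≤ ρ := (Finset.sum_nonneg fun a _ => hdef0 (χ a)).trans hdef
  obtain ⟨Y, hY⟩ := hτ
  have hYV : ∑ i, ∑ j, (Y (τ i) j - V i j) ^ 2 ≤ (1 + η) * (k / n * ρ) := by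
    have h1 := hY σ θ
    simp only [frobSq, Matrix.sub_apply, membership_mul_apply] at h1
    exact h1.trans (mul_le_mul_of_nonneg_left hideal (by linarith))
  have hκ : ∑ i, ∑ j, (Y (τ i) j - θ (σ i) j) ^ 2 ≤ 2 * (2 + η) * (k / n * ρ) := by
    calc ∑ i, ∑ j, (Y (τ i) j - θ (σ i) j) ^ 2
        ≤ ∑ i, ∑ j, (2 * (Y (τ i) j - V i j) ^ 2 + 2 * (θ (σ i) j - V i j) ^ 2) := by
          refine Finset.sum_le_sum fun i _ => Finset.sum_le_sum fun j _ => ?_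
          linarith [sq_nonneg ((Y (τ i) j - V i j) + (θ (σ i) j - V i j))]
      _ = 2 * ∑ i, ∑ j, (Y (τ i) j - V i j) ^ 2 + 2 * ∑ i, ∑ j, (θ (σ i) j - V i j) ^ 2 := by
          simp only [Finset.sum_add_distrib, Finset.mul_sum]
      _ ≤ _ := by linarith
  -- From `hsmall`, dropping the term in η.
  have hnρ : k * ρ ≤ n / 16 := by
    have : 0 ≤ (k : ℝ) * (8 * η * ρ) := by positivity
    linarith
  -- ‖χ_a − χ_b‖² = 2n/k, and the projection loses at most 2ρ ≤ n/(8k), so at least n/k remains;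
  -- scaling by (k/n)² gives k/n.
  have hsep : ∀ a b, a ≠ b → (k / n : ℝ) ≤ ∑ j, (θ a j - θ b j) ^ 2 := by
    intro a b hab
    have h1 : ∑ j, (θ a j - θ b j) ^ 2 =
        (k / n : ℝ) ^ 2 * ((Vᵀ *ᵥ (χ a - χ b)) ⬝ᵥ (Vᵀ *ᵥ (χ a - χ b))) := by
      rw [mulVec_sub, dotProduct, Finset.mul_sum]
      refine Finset.sum_congr rfl fun j _ => ?_
      simp only [hθ, hm, Pi.sub_apply]
      ring
    have h2 : (χ a - χ b) ⬝ᵥ (χ a - χ b) = n / k * 2 := by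
      have h3 := sum_comp_eq_of_isBalanced hk0 hσ fun q => (centered a q - centered b q) ^ 2
      have h4 : ∑ q, (centered a q - centered b q) ^ 2 = 2 := by
        have h5 : ∀ q : Fin k, (centered a q - centered b q) ^ 2 =
            (if q = a then 1 else 0) + (if q = b then 1 else 0) := fun q => by
          unfold centered
          by_cases hqa : q = a
          · subst hqa
            rw [if_pos rfl, if_neg hab]
            ring
          · by_cases hqb : q = b
            · subst hqb
              rw [if_pos rfl, if_neg hqa]
              ring
            · simp [hqa, hqb]
        simp only [h5, Finset.sum_add_distrib, Finset.sum_ite_eq', Finset.mem_univ, if_true]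
        norm_num
      rw [h4] at h3
      simpa only [dotProduct, hχ, sq, Pi.sub_apply] using h3
    have h6 : (χ a - χ b) ⬝ᵥ (χ a - χ b) - (Vᵀ *ᵥ (χ a - χ b)) ⬝ᵥ (Vᵀ *ᵥ (χ a - χ b)) ≤
        2 * ρ := by
      rw [← residual_dotProduct hVV, mulVec_sub]
      have h7 : ∀ x y : Fin n → ℝ, (x - y) ⬝ᵥ (x - y) ≤ 2 * (x ⬝ᵥ x + y ⬝ᵥ y) := fun x y => by
        simp only [dotProduct, ← Finset.sum_add_distrib, Finset.mul_sum, Pi.sub_apply]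
        refine Finset.sum_le_sum fun l _ => ?_
        linarith [mul_self_nonneg (x l + y l)]
      refine (h7 _ _).trans ?_
      rw [residual_dotProduct hVV, residual_dotProduct hVV]
      have h8 := Finset.sum_le_sum_of_subset_of_nonneg (Finset.subset_univ {a, b})
        (fun q _ _ => hdef0 (χ q))
      rw [Finset.sum_pair hab] at h8
      linarith
    rw [h1]
    rw [h2] at h6
    have h9 : (n / k : ℝ) ≤ (Vᵀ *ᵥ (χ a - χ b)) ⬝ᵥ (Vᵀ *ᵥ (χ a - χ b)) := by
      have : ρ ≤ n / k / 16 := by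
        rw [div_div, mul_comm (k : ℝ), ← div_div, le_div_iff₀ hk']
        linarith
      have : (0 : ℝ) < n / k := by positivity
      linarith
    calc (k / n : ℝ) = (k / n : ℝ) ^ 2 * (n / k) := by field_simp
      _ ≤ _ := mul_le_mul_of_nonneg_left h9 (sq_nonneg _)
  have hval : 4 * (2 * (2 + η) * (k / n * ρ)) / (k / n) = 8 * (2 + η) * ρ := by
    field_simp
    ring
  have := absError_le_of_centers hσ Y θ (D := k / n) (by positivity) hsep hκ
    (by rw [hval]; exact hsmall)
  rwa [hval] at this

/-! ### Expected residuals -/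

theorem norm_add_sq_le_two {E : Type*} [SeminormedAddCommGroup E] (x y : E) :
    ‖x + y‖ ^ 2 ≤ 2 * ‖x‖ ^ 2 + 2 * ‖y‖ ^ 2 := by
  have h := pow_le_pow_left₀ (norm_nonneg _) (norm_add_le x y) 2
  linarith [sq_nonneg (‖x‖ - ‖y‖)]

theorem norm_sq_eq_re_add_im (z : ℂ) : ‖z‖ ^ 2 = z.re ^ 2 + z.im ^ 2 := by
  rw [← Complex.normSq_eq_norm_sq, Complex.normSq_apply, sq, sq]

theorem sum_weight_norm_noise_sum_sq_le {n : ℕ} {p : Fin n → Fin n → ℝ}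
    (hp : ∀ i j, p i j ∈ Set.Icc (0 : ℝ) 1) (hs : ∀ i j, p i j = p j i) (i : Fin n)
    (g : Fin n → ℂ) (hg : ∀ l, ‖g l‖ ≤ 1) :
    ∑ G, weight p G * ‖∑ l, (noise p G i l : ℂ) * g l‖ ^ 2 ≤ 2 * n := by
  have h1 : ∀ G, weight p G * ‖∑ l, (noise p G i l : ℂ) * g l‖ ^ 2 =
      weight p G * (∑ l, noise p G i l * (g l).re) ^ 2 +
        weight p G * (∑ l, noise p G i l * (g l).im) ^ 2 := fun G => by
    rw [norm_sq_eq_re_add_im, Complex.re_sum, Complex.im_sum, mul_add]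
    simp only [Complex.re_ofReal_mul, Complex.im_ofReal_mul]
  simp only [h1, Finset.sum_add_distrib]
  have h2 := sum_weight_noise_sum_sq_le hp hs i (fun l => (g l).re)
    fun l => (Complex.abs_re_le_norm _).trans (hg l)
  have h3 := sum_weight_noise_sum_sq_le hp hs i (fun l => (g l).im)
    fun l => (Complex.abs_im_le_norm _).trans (hg l)
  linarith

/-- The centered function `e^{-2πi⟨z,x⟩} F(x) - F̂(z)`. -/
def centeredChar {d : ℕ} (F : UnitAddTorus (Fin d) → ℝ) (z : Fin d → ℤ)
    (x : UnitAddTorus (Fin d)) : ℂ :=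
  UnitAddTorus.mFourier (-z) x * (F x : ℂ) - fourierCoeff F z

theorem measurable_centeredChar {d : ℕ} {F : UnitAddTorus (Fin d) → ℝ} (hF : IsConnectivity F)
    (z : Fin d → ℤ) : Measurable (centeredChar F z) :=
  ((UnitAddTorus.mFourier (-z)).continuous.measurable.mul
    (Complex.measurable_ofReal.comp hF.measurable)).sub measurable_const

theorem norm_centeredChar_le {d : ℕ} {F : UnitAddTorus (Fin d) → ℝ} (hF : IsConnectivity F)
    (z : Fin d → ℤ) (x : UnitAddTorus (Fin d)) : ‖centeredChar F z x‖ ≤ 2 := by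
  refine (norm_sub_le _ _).trans ?_
  rw [norm_mul, norm_mFourier_apply, one_mul, Complex.norm_real, Real.norm_eq_abs]
  linarith [hF.abs_apply_le x, norm_fourierCoeff_le hF z]

theorem integral_centeredChar {d : ℕ} {F : UnitAddTorus (Fin d) → ℝ} (hF : IsConnectivity F)
    (z : Fin d → ℤ) : ∫ x, centeredChar F z x ∂(torusMeasure d) = 0 := by
  unfold centeredChar
  rw [integral_sub, ← fourierCoeff_eq]
  · simp
  · refine Integrable.of_bound ((UnitAddTorus.mFourier (-z)).continuous.measurable.mul
      (Complex.measurable_ofReal.comp hF.measurable)).aestronglyMeasurable 1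
        (ae_of_all _ fun x => ?_)
    rw [norm_mul, norm_mFourier_apply, one_mul, Complex.norm_real, Real.norm_eq_abs]
    exact hF.abs_apply_le x
  · exact integrable_const _

/-- The fluctuation, due to the positions, of the action on the vector `modulated X σ z c`. -/
def drift {d n k : ℕ} (F_in F_out : UnitAddTorus (Fin d) → ℝ) (σ : Fin n → Fin k)
    (z : Fin d → ℤ) (c : Fin k → ℝ) (X : Fin n → UnitAddTorus (Fin d)) (i : Fin n) : ℂ :=
  ∑ l ∈ Finset.univ.erase i,
    centeredChar (blockFun F_in F_out (σ i) (σ l)) z (X i - X l) * (c (σ l) : ℂ)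

theorem measurable_drift {d n k : ℕ} {F_in F_out : UnitAddTorus (Fin d) → ℝ}
    (hF_in : IsConnectivity F_in) (hF_out : IsConnectivity F_out) (σ : Fin n → Fin k)
    (z : Fin d → ℤ) (c : Fin k → ℝ) (i : Fin n) :
    Measurable fun X => drift F_in F_out σ z c X i := by
  unfold drift
  refine Finset.measurable_fun_sum _ fun l _ => Measurable.mul_const ?_ _
  exact (measurable_centeredChar (blockFun_isConnectivity hF_in hF_out _ _) z).comp
    (measurable_sub_positions i l)

theorem norm_drift_le {d n k : ℕ} {F_in F_out : UnitAddTorus (Fin d) → ℝ}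
    (hF_in : IsConnectivity F_in) (hF_out : IsConnectivity F_out) (σ : Fin n → Fin k)
    (z : Fin d → ℤ) {c : Fin k → ℝ} (hc : ∀ a, |c a| ≤ 1) (X : Fin n → UnitAddTorus (Fin d))
    (i : Fin n) : ‖drift F_in F_out σ z c X i‖ ≤ 2 * n := by
  refine (norm_sum_le _ _).trans ?_
  calc _ ≤ ∑ _l ∈ Finset.univ.erase i, (2 : ℝ) := by
        refine Finset.sum_le_sum fun l _ => ?_
        rw [norm_mul, Complex.norm_real, Real.norm_eq_abs]
        calc _ ≤ (2 : ℝ) * 1 := mul_le_mul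
              (norm_centeredChar_le (blockFun_isConnectivity hF_in hF_out _ _) z _) (hc _)
              (abs_nonneg _) (by norm_num)
          _ = 2 := by norm_num
    _ ≤ ∑ _l : Fin n, (2 : ℝ) :=
        Finset.sum_le_sum_of_subset_of_nonneg (Finset.erase_subset _ _) fun _ _ _ => by norm_num
    _ = 2 * n := by simp [mul_comm]

theorem integrable_norm_drift_sq {d n k : ℕ} {F_in F_out : UnitAddTorus (Fin d) → ℝ}
    (hF_in : IsConnectivity F_in) (hF_out : IsConnectivity F_out) (σ : Fin n → Fin k)
    (z : Fin d → ℤ) {c : Fin k → ℝ} (hc : ∀ a, |c a| ≤ 1) (i : Fin n) :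
    Integrable (fun X => ‖drift F_in F_out σ z c X i‖ ^ 2) (positions d n) :=
  integrable_of_bounded ((measurable_drift hF_in hF_out σ z c i).norm.pow_const 2)
    (c := (2 * n) ^ 2) fun X => by
      rw [abs_of_nonneg (sq_nonneg _)]
      exact pow_le_pow_left₀ (norm_nonneg _) (norm_drift_le hF_in hF_out σ z hc X i) 2

/-- The summands are centered, pairwise orthogonal and of modulus at most 2, so the real and
imaginary parts contribute at most 4n each. -/
theorem integral_norm_drift_sq_le {d n k : ℕ} {F_in F_out : UnitAddTorus (Fin d) → ℝ}
    (hF_in : IsConnectivity F_in) (hF_out : IsConnectivity F_out) (σ : Fin n → Fin k)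
    (z : Fin d → ℤ) {c : Fin k → ℝ} (hc : ∀ a, |c a| ≤ 1) (i : Fin n) :
    ∫ X, ‖drift F_in F_out σ z c X i‖ ^ 2 ∂(positions d n) ≤ 8 * n := by
  set h : Fin n → UnitAddTorus (Fin d) → ℂ := fun l x =>
    centeredChar (blockFun F_in F_out (σ i) (σ l)) z x * (c (σ l) : ℂ) with hh
  have hconn := fun l => blockFun_isConnectivity hF_in hF_out (σ i) (σ l)
  have hmeas : ∀ l, Measurable (h l) := fun l => (measurable_centeredChar (hconn l) z).mul_const _
  have hbound : ∀ l x, ‖h l x‖ ≤ 2 := fun l x => by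
    simp only [hh, norm_mul, Complex.norm_real, Real.norm_eq_abs]
    calc _ ≤ (2 : ℝ) * 1 := mul_le_mul (norm_centeredChar_le (hconn l) z _) (hc _)
          (abs_nonneg _) (by norm_num)
      _ = 2 := by norm_num
  have hint : ∀ l, Integrable (h l) (torusMeasure d) := fun l =>
    Integrable.of_bound (hmeas l).aestronglyMeasurable 2 (ae_of_all _ (hbound l))
  have hzero : ∀ l, ∫ x, h l x ∂(torusMeasure d) = 0 := fun l => by
    simp only [hh]
    rw [integral_mul_const, integral_centeredChar (hconn l), zero_mul]
  have hre := integral_positions_sum_sq_le (d := d) i (h := fun l x => (h l x).re)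
    (fun l => Complex.measurable_re.comp (hmeas l)) (c := 2)
    (fun l x => (Complex.abs_re_le_norm _).trans (hbound l x)) (fun l => by
      have := integral_re (hint l)
      rw [hzero] at this
      simpa using this)
  have him := integral_positions_sum_sq_le (d := d) i (h := fun l x => (h l x).im)
    (fun l => Complex.measurable_im.comp (hmeas l)) (c := 2)
    (fun l x => (Complex.abs_im_le_norm _).trans (hbound l x)) (fun l => by
      have := integral_im (hint l)
      rw [hzero] at this
      simpa using this)
  have heq : ∀ X, ‖drift F_in F_out σ z c X i‖ ^ 2 =
      (∑ l ∈ Finset.univ.erase i, (h l (X i - X l)).re) ^ 2 +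
        (∑ l ∈ Finset.univ.erase i, (h l (X i - X l)).im) ^ 2 := fun X => by
    rw [norm_sq_eq_re_add_im, drift, Complex.re_sum, Complex.im_sum]
  have hsub := integrable_norm_drift_sq hF_in hF_out σ z hc i
  simp only [heq] at hsub ⊢
  have hmre : Measurable fun X : Fin n → UnitAddTorus (Fin d) =>
      (∑ l ∈ Finset.univ.erase i, (h l (X i - X l)).re) ^ 2 :=
    (Finset.measurable_fun_sum _ fun l _ => Complex.measurable_re.comp
      ((hmeas l).comp (measurable_sub_positions i l))).pow_const 2
  have hmim : Measurable fun X : Fin n → UnitAddTorus (Fin d) =>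
      (∑ l ∈ Finset.univ.erase i, (h l (X i - X l)).im) ^ 2 :=
    (Finset.measurable_fun_sum _ fun l _ => Complex.measurable_im.comp
      ((hmeas l).comp (measurable_sub_positions i l))).pow_const 2
  rw [integral_add]
  · linarith
  · refine hsub.mono' hmre.aestronglyMeasurable (ae_of_all _ fun X => ?_)
    rw [Real.norm_eq_abs, abs_of_nonneg (sq_nonneg _)]
    exact le_add_of_nonneg_right (sq_nonneg _)
  · refine hsub.mono' hmim.aestronglyMeasurable (ae_of_all _ fun X => ?_)
    rw [Real.norm_eq_abs, abs_of_nonneg (sq_nonneg _)]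
    exact le_add_of_nonneg_left (sq_nonneg _)

/-- An upper bound for the conditional expectation of the residual given the positions. -/
def residualBound {d n k : ℕ} (F_in F_out : UnitAddTorus (Fin d) → ℝ) (σ : Fin n → Fin k)
    (z : Fin d → ℤ) (c : Fin k → ℝ) (X : Fin n → UnitAddTorus (Fin d)) : ℝ :=
  ∑ i, (4 * n + 4 + 4 * ‖drift F_in F_out σ z c X i‖ ^ 2)

theorem integrable_residualBound {d n k : ℕ} {F_in F_out : UnitAddTorus (Fin d) → ℝ}
    (hF_in : IsConnectivity F_in) (hF_out : IsConnectivity F_out) (σ : Fin n → Fin k)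
    (z : Fin d → ℤ) {c : Fin k → ℝ} (hc : ∀ a, |c a| ≤ 1) :
    Integrable (residualBound F_in F_out σ z c) (positions d n) :=
  integrable_finsetSum _ fun i _ => (integrable_const _).add
    ((integrable_norm_drift_sq hF_in hF_out σ z hc i).const_mul 4)

theorem integral_residualBound_le {d n k : ℕ} {F_in F_out : UnitAddTorus (Fin d) → ℝ}
    (hF_in : IsConnectivity F_in) (hF_out : IsConnectivity F_out) (σ : Fin n → Fin k)
    (z : Fin d → ℤ) {c : Fin k → ℝ} (hc : ∀ a, |c a| ≤ 1) :
    ∫ X, residualBound F_in F_out σ z c X ∂(positions d n) ≤ 40 * (n : ℝ) ^ 2 := by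
  unfold residualBound
  have hd := fun i => (integrable_norm_drift_sq hF_in hF_out σ z hc i).const_mul 4
  have hd' : ∀ i, Integrable (fun X => 4 * (n : ℝ) + 4 + 4 * ‖drift F_in F_out σ z c X i‖ ^ 2)
      (positions d n) := fun i => (integrable_const _).add (hd i)
  rw [integral_finsetSum _ fun i _ => hd' i]
  calc _ ≤ ∑ _i : Fin n, (40 * (n : ℝ)) := by
        refine Finset.sum_le_sum fun i _ => ?_
        rw [integral_add (integrable_const _) (hd i), integral_const_mul]
        have h1 := integral_norm_drift_sq_le hF_in hF_out σ z hc i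
        -- This absorbs the constant: 4n + 4 + 4 · 8n ≤ 40n.
        have h2 : (1 : ℝ) ≤ n := by
          have : 1 ≤ n := Nat.one_le_of_lt i.2
          exact_mod_cast this
        simp only [integral_const, probReal_univ, one_smul]
        linarith
    _ = 40 * (n : ℝ) ^ 2 := by
        simp only [Finset.sum_const, Finset.card_univ, Fintype.card_fin, nsmul_eq_mul]
        ring

theorem fourierCoeff_blockFun {d k : ℕ} (F_in F_out : UnitAddTorus (Fin d) → ℝ) (a b : Fin k)
    (z : Fin d → ℤ) : fourierCoeff (blockFun F_in F_out a b) z =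
      if a = b then fourierCoeff F_in z else fourierCoeff F_out z := by
  unfold blockFun
  split_ifs <;> rfl

/-- The action of the adjacency matrix on `modulated X σ z c`. -/
theorem adj_sum_modulated {d n k : ℕ} (hk : k ≠ 0) (F_in F_out : UnitAddTorus (Fin d) → ℝ)
    {σ : Fin n → Fin k} (hσ : IsBalanced σ) (X : Fin n → UnitAddTorus (Fin d))
    (G : SimpleGraph (Fin n)) (z : Fin d → ℤ) {c : Fin k → ℝ} {ν : ℂ}
    (hν : ∀ a, ∑ b, (if a = b then fourierCoeff F_in z else fourierCoeff F_out z) * (c b : ℂ) =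
      k * ν * c a) (i : Fin n) :
    (∑ l, (adj G i l : ℂ) * modulated X σ z c l) - n * ν * modulated X σ z c i =
      (∑ l, (noise (edgeProb F_in F_out σ X) G i l : ℂ) * modulated X σ z c l) +
        UnitAddTorus.mFourier z (X i) *
          (drift F_in F_out σ z c X i - fourierCoeff F_in z * c (σ i)) := by
  have hk' : (k : ℂ) ≠ 0 := Nat.cast_ne_zero.2 hk
  -- Balance turns the eigenvalue equation of the k × k block matrix into a sum over the vertices.
  have h1 : (n : ℂ) * ν * modulated X σ z c i = UnitAddTorus.mFourier z (X i) *
      ∑ l, fourierCoeff (blockFun F_in F_out (σ i) (σ l)) z * (c (σ l) : ℂ) := by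
    have h2 := sum_comp_eq_of_isBalanced hk hσ fun b =>
      (if σ i = b then fourierCoeff F_in z else fourierCoeff F_out z) * (c b : ℂ)
    rw [hν] at h2
    simp only [fourierCoeff_blockFun, h2, modulated]
    field_simp
  have h3 : ∀ l, (adj G i l : ℂ) * modulated X σ z c l =
      (noise (edgeProb F_in F_out σ X) G i l : ℂ) * modulated X σ z c l +
        (if i = l then 0 else (edgeProb F_in F_out σ X i l : ℂ) * modulated X σ z c l) := by
    intro l
    rw [adj_eq_noise_add (edgeProb F_in F_out σ X)]
    split_ifs
    · simp
    · push_cast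
      ring
  have h4 : ∀ l, i ≠ l → (edgeProb F_in F_out σ X i l : ℂ) * modulated X σ z c l =
      UnitAddTorus.mFourier z (X i) *
        (centeredChar (blockFun F_in F_out (σ i) (σ l)) z (X i - X l) * (c (σ l) : ℂ) +
          fourierCoeff (blockFun F_in F_out (σ i) (σ l)) z * (c (σ l) : ℂ)) := by
    intro l _
    have h5 : UnitAddTorus.mFourier z (X l) =
        UnitAddTorus.mFourier z (X i) * UnitAddTorus.mFourier (-z) (X i - X l) := by
      have h6 : X i = (X i - X l) + X l := (sub_add_cancel _ _).symm
      have h7 : UnitAddTorus.mFourier z (X i - X l) * UnitAddTorus.mFourier (-z) (X i - X l) =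
          1 := by
        rw [← UnitAddTorus.mFourier_add, add_neg_cancel, UnitAddTorus.mFourier_zero]
        rfl
      have h8 := mFourier_apply_add z (X i - X l) (X l)
      rw [← h6] at h8
      rw [h8, mul_right_comm, h7, one_mul]
    rw [edgeProb_eq, modulated, centeredChar, h5]
    ring
  have h9 : ∑ l, (if i = l then 0 else (edgeProb F_in F_out σ X i l : ℂ) * modulated X σ z c l) =
      UnitAddTorus.mFourier z (X i) * (drift F_in F_out σ z c X i +
        ∑ l ∈ Finset.univ.erase i,
          fourierCoeff (blockFun F_in F_out (σ i) (σ l)) z * (c (σ l) : ℂ)) := by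
    rw [← Finset.add_sum_erase _ _ (Finset.mem_univ i), if_pos rfl, zero_add, drift,
      ← Finset.sum_add_distrib, Finset.mul_sum]
    refine Finset.sum_congr rfl fun l hl => ?_
    have hil : i ≠ l := (Finset.ne_of_mem_erase hl).symm
    rw [if_neg hil, h4 l hil]
  simp only [h3, Finset.sum_add_distrib]
  -- The term l = i is absent from the graph but present in the eigenvalue equation, which produces
  -- the correction −F̂_in(z) c(σ i).
  rw [h9, h1, ← Finset.add_sum_erase _ (fun l =>
    fourierCoeff (blockFun F_in F_out (σ i) (σ l)) z * (c (σ l) : ℂ)) (Finset.mem_univ i),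
    fourierCoeff_blockFun F_in F_out (σ i) (σ i), if_pos rfl]
  ring

/-- Given the positions, the noise contributes at most 2 · 2n to each coordinate, and the drift with
its bounded diagonal correction at most 2(2|drift|² + 2). -/
theorem sum_weight_residual_le {d n k : ℕ} (hk : k ≠ 0) {F_in F_out : UnitAddTorus (Fin d) → ℝ}
    (hF_in : IsConnectivity F_in) (hF_out : IsConnectivity F_out)
    {σ : Fin n → Fin k} (hσ : IsBalanced σ) (X : Fin n → UnitAddTorus (Fin d))
    (z : Fin d → ℤ) {c : Fin k → ℝ} (hc : ∀ a, |c a| ≤ 1) {ν : ℂ}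
    (hν : ∀ a, ∑ b, (if a = b then fourierCoeff F_in z else fourierCoeff F_out z) * (c b : ℂ) =
      k * ν * c a) :
    ∑ G, weight (edgeProb F_in F_out σ X) G * residual G (n * ν) (modulated X σ z c) ≤
      residualBound F_in F_out σ z c X := by
  set p := edgeProb F_in F_out σ X with hp
  have hp1 := edgeProb_mem_Icc hF_in hF_out σ X
  have hg : ∀ l, ‖modulated X σ z c l‖ ≤ 1 := fun l => by
    rw [modulated, norm_mul, norm_mFourier_apply, one_mul, Complex.norm_real, Real.norm_eq_abs]
    exact hc _
  simp only [residual, residualBound, Finset.mul_sum]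
  rw [Finset.sum_comm]
  refine Finset.sum_le_sum fun i _ => ?_
  set D : ℝ := ‖drift F_in F_out σ z c X i - fourierCoeff F_in z * c (σ i)‖ ^ 2 with hD
  have hDle : D ≤ 2 * ‖drift F_in F_out σ z c X i‖ ^ 2 + 2 := by
    rw [hD, sub_eq_add_neg]
    refine (norm_add_sq_le_two _ _).trans ?_
    have h1 : ‖-(fourierCoeff F_in z * (c (σ i) : ℂ))‖ ≤ 1 := by
      rw [norm_neg, norm_mul, Complex.norm_real, Real.norm_eq_abs]
      exact mul_le_one₀ (norm_fourierCoeff_le hF_in z) (abs_nonneg _) (hc _)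
    have h2 := pow_le_one₀ (norm_nonneg _) h1 (n := 2)
    linarith
  calc _ ≤ ∑ G, (2 * (weight p G * ‖∑ l, (noise p G i l : ℂ) * modulated X σ z c l‖ ^ 2) +
        weight p G * (2 * D)) := by
        refine Finset.sum_le_sum fun G _ => ?_
        rw [adj_sum_modulated hk F_in F_out hσ X G z hν i]
        have h1 := norm_add_sq_le_two
          (∑ l, (noise p G i l : ℂ) * modulated X σ z c l)
          (UnitAddTorus.mFourier z (X i) *
            (drift F_in F_out σ z c X i - fourierCoeff F_in z * c (σ i)))
        rw [norm_mul, norm_mFourier_apply, one_mul] at h1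
        have h2 := mul_le_mul_of_nonneg_left h1 (weight_nonneg hp1 G)
        linarith
    _ ≤ _ := by
        rw [Finset.sum_add_distrib, ← Finset.mul_sum, ← Finset.sum_mul, sum_weight, one_mul]
        have := sum_weight_norm_noise_sum_sq_le hp1 (edgeProb_symm hF_in hF_out σ X) i _ hg
        linarith

theorem abs_centered_le {k : ℕ} (a b : Fin k) : |centered a b| ≤ 1 := by
  have hk : (1 : ℝ) ≤ k := by
    have : 1 ≤ k := Nat.one_le_of_lt a.2
    exact_mod_cast this
  have h1 : (k : ℝ)⁻¹ ≤ 1 := inv_le_one_of_one_le₀ hk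
  have h2 : 0 ≤ (k : ℝ)⁻¹ := by positivity
  unfold centered
  rw [abs_le]
  split_ifs <;> constructor <;> linarith

/-- An upper bound for the conditional expectation of `freqResidual` given the positions. -/
def freqResidualBound {d n k : ℕ} (F_in F_out : UnitAddTorus (Fin d) → ℝ) (σ : Fin n → Fin k)
    (z : Fin d → ℤ) (X : Fin n → UnitAddTorus (Fin d)) : ℝ :=
  ∑ a, residualBound F_in F_out σ z (centered a) X + residualBound F_in F_out σ z 1 X

theorem sum_block_mul {k : ℕ} (α β : ℂ) (c : Fin k → ℂ) (a : Fin k) :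
    ∑ b, (if a = b then α else β) * c b = (α - β) * c a + β * ∑ b, c b := by
  have h1 : ∀ b, (if a = b then α else β) * c b = (if a = b then (α - β) * c b else 0) + β * c b :=
    fun b => by split_ifs <;> ring
  simp only [h1, Finset.sum_add_distrib, ← Finset.mul_sum]
  simp

/-- The vectors `centered a` have sum zero and the vector 1 is constant, so both are eigenvectors of
the block matrix, with k times the contrast and mean eigenvalues. -/
theorem sum_weight_freqResidual_le {d n k : ℕ} (hk : k ≠ 0)
    {F_in F_out : UnitAddTorus (Fin d) → ℝ} (hF_in : IsConnectivity F_in)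
    (hF_out : IsConnectivity F_out) {σ : Fin n → Fin k} (hσ : IsBalanced σ)
    (X : Fin n → UnitAddTorus (Fin d)) (z : Fin d → ℤ) :
    ∑ G, weight (edgeProb F_in F_out σ X) G * freqResidual F_in F_out σ X G z ≤
      freqResidualBound F_in F_out σ z X := by
  have hk' : (k : ℂ) ≠ 0 := Nat.cast_ne_zero.2 hk
  simp only [freqResidual, freqResidualBound, mul_add, Finset.sum_add_distrib, Finset.mul_sum]
  rw [Finset.sum_comm]
  refine add_le_add (Finset.sum_le_sum fun a _ => ?_) ?_
  · refine sum_weight_residual_le hk hF_in hF_out hσ X z (abs_centered_le a) fun b => ?_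
    rw [sum_block_mul, ← Complex.ofReal_sum, sum_centered hk, contrastEigval,
      mul_div_cancel₀ _ hk']
    simp
  · refine sum_weight_residual_le hk hF_in hF_out hσ X z (by simp) fun b => ?_
    rw [sum_block_mul, meanEigval, mul_div_cancel₀ _ hk']
    simp
    ring

theorem integrable_freqResidualBound {d n k : ℕ} {F_in F_out : UnitAddTorus (Fin d) → ℝ}
    (hF_in : IsConnectivity F_in) (hF_out : IsConnectivity F_out) (σ : Fin n → Fin k)
    (z : Fin d → ℤ) : Integrable (freqResidualBound F_in F_out σ z) (positions d n) :=
  (integrable_finsetSum _ fun a _ => integrable_residualBound hF_in hF_out σ z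
    (abs_centered_le a)).add (integrable_residualBound hF_in hF_out σ z (by simp))

theorem integral_freqResidualBound_le {d n k : ℕ} {F_in F_out : UnitAddTorus (Fin d) → ℝ}
    (hF_in : IsConnectivity F_in) (hF_out : IsConnectivity F_out) (σ : Fin n → Fin k)
    (z : Fin d → ℤ) :
    ∫ X, freqResidualBound F_in F_out σ z X ∂(positions d n) ≤ (k + 1) * (40 * (n : ℝ) ^ 2) := by
  unfold freqResidualBound
  have h1 := fun a : Fin k => integrable_residualBound hF_in hF_out σ z (abs_centered_le a)
  rw [integral_add (integrable_finsetSum _ fun a _ => h1 a)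
    (integrable_residualBound hF_in hF_out σ z (by simp)), integral_finsetSum _ fun a _ => h1 a]
  have h2 : ∑ a : Fin k, ∫ X, residualBound F_in F_out σ z (centered a) X ∂(positions d n) ≤
      ∑ _a : Fin k, 40 * (n : ℝ) ^ 2 := Finset.sum_le_sum fun a _ =>
    integral_residualBound_le hF_in hF_out σ z (abs_centered_le a)
  have h3 := integral_residualBound_le hF_in hF_out σ z (c := 1) (by simp)
  rw [Finset.sum_const, Finset.card_univ, Fintype.card_fin, nsmul_eq_mul] at h2
  linarith

/-! ### The expected truncation error -/

theorem norm_truncation_le {d n k : ℕ} {F_in F_out : UnitAddTorus (Fin d) → ℝ}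
    (hF_in : IsConnectivity F_in) (hF_out : IsConnectivity F_out) (σ : Fin n → Fin k)
    (S : Finset (Fin d → ℤ)) (X : Fin n → UnitAddTorus (Fin d)) (i j : Fin n) :
    ‖((if i = j then 0 else edgeProb F_in F_out σ X i j : ℝ) : ℂ) -
      partialFourier (blockFun F_in F_out (σ i) (σ j)) S (X i - X j)‖ ≤ 1 + S.card := by
  refine (norm_sub_le _ _).trans (add_le_add ?_
    (norm_partialFourier_le (blockFun_isConnectivity hF_in hF_out _ _) _ _))
  rw [Complex.norm_real, Real.norm_eq_abs]
  split_ifs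
  · simp
  · rw [edgeProb_eq]
    exact (blockFun_isConnectivity hF_in hF_out _ _).abs_apply_le _

theorem measurable_truncation {d n k : ℕ} {F_in F_out : UnitAddTorus (Fin d) → ℝ}
    (hF_in : IsConnectivity F_in) (hF_out : IsConnectivity F_out) (σ : Fin n → Fin k)
    (S : Finset (Fin d → ℤ)) (i j : Fin n) :
    Measurable fun X : Fin n → UnitAddTorus (Fin d) =>
      ‖((if i = j then 0 else edgeProb F_in F_out σ X i j : ℝ) : ℂ) -
        partialFourier (blockFun F_in F_out (σ i) (σ j)) S (X i - X j)‖ ^ 2 := by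
  refine (Measurable.norm (Measurable.sub ?_ ?_)).pow_const 2
  · refine Complex.measurable_ofReal.comp ?_
    split_ifs
    · exact measurable_const
    · simp only [edgeProb_eq]
      exact (blockFun_isConnectivity hF_in hF_out _ _).measurable.comp
        (measurable_sub_positions i j)
  · exact (continuous_partialFourier _ S).measurable.comp (measurable_sub_positions i j)

theorem integrable_truncation {d n k : ℕ} {F_in F_out : UnitAddTorus (Fin d) → ℝ}
    (hF_in : IsConnectivity F_in) (hF_out : IsConnectivity F_out) (σ : Fin n → Fin k)
    (S : Finset (Fin d → ℤ)) (i j : Fin n) :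
    Integrable (fun X : Fin n → UnitAddTorus (Fin d) =>
      ‖((if i = j then 0 else edgeProb F_in F_out σ X i j : ℝ) : ℂ) -
        partialFourier (blockFun F_in F_out (σ i) (σ j)) S (X i - X j)‖ ^ 2) (positions d n) :=
  integrable_of_bounded (measurable_truncation hF_in hF_out σ S i j) (c := (1 + S.card) ^ 2)
    fun X => by
      rw [abs_of_nonneg (sq_nonneg _)]
      exact pow_le_pow_left₀ (norm_nonneg _) (norm_truncation_le hF_in hF_out σ S X i j) 2

theorem integrable_truncationError {d n k : ℕ} {F_in F_out : UnitAddTorus (Fin d) → ℝ}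
    (hF_in : IsConnectivity F_in) (hF_out : IsConnectivity F_out) (σ : Fin n → Fin k)
    (S : Finset (Fin d → ℤ)) :
    Integrable (truncationError F_in F_out σ S) (positions d n) :=
  integrable_finsetSum _ fun i _ => integrable_finsetSum _ fun j _ =>
    integrable_truncation hF_in hF_out σ S i j

/-- Off the diagonal X_i − X_j is uniform, so each entry gives the L² error of a Fourier series. The
n diagonal entries are bounded trivially, which is harmless at scale n². -/
theorem integral_truncationError_le {d n k : ℕ} {F_in F_out : UnitAddTorus (Fin d) → ℝ}
    (hF_in : IsConnectivity F_in) (hF_out : IsConnectivity F_out) (σ : Fin n → Fin k)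
    (S : Finset (Fin d → ℤ)) {κ : ℝ}
    (h_in : ∫ x, ‖(F_in x : ℂ) - partialFourier F_in S x‖ ^ 2 ∂(torusMeasure d) ≤ κ)
    (h_out : ∫ x, ‖(F_out x : ℂ) - partialFourier F_out S x‖ ^ 2 ∂(torusMeasure d) ≤ κ) :
    ∫ X, truncationError F_in F_out σ S X ∂(positions d n) ≤
      n * (1 + S.card) ^ 2 + n ^ 2 * κ := by
  have hκ : 0 ≤ κ := (integral_nonneg fun _ => sq_nonneg _).trans h_in
  unfold truncationError
  rw [integral_finsetSum _ fun i _ => integrable_finsetSum _ fun j _ =>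
    integrable_truncation hF_in hF_out σ S i j]
  calc _ ≤ ∑ i : Fin n, ∑ j : Fin n, ((if i = j then (1 + (S.card : ℝ)) ^ 2 else 0) + κ) := by
        refine Finset.sum_le_sum fun i _ => ?_
        rw [integral_finsetSum _ fun j _ => integrable_truncation hF_in hF_out σ S i j]
        refine Finset.sum_le_sum fun j _ => ?_
        by_cases hij : i = j
        · rw [if_pos hij]
          refine (integral_le_of_le (integrable_truncation hF_in hF_out σ S i j) fun X =>
            pow_le_pow_left₀ (norm_nonneg _) (norm_truncation_le hF_in hF_out σ S X i j) 2).trans ?_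
          linarith
        · simp only [if_neg hij, zero_add, edgeProb_eq]
          have hconn := blockFun_isConnectivity hF_in hF_out (σ i) (σ j)
          have h1 := integral_positions_pair (d := d) hij (g := fun x =>
            ‖((blockFun F_in F_out (σ i) (σ j) x : ℝ) : ℂ) -
              partialFourier (blockFun F_in F_out (σ i) (σ j)) S x‖ ^ 2)
            (((Complex.measurable_ofReal.comp hconn.measurable).sub
              (continuous_partialFourier _ S).measurable).norm.pow_const 2)
            (c := (1 + S.card) ^ 2) (fun x => by
              rw [abs_of_nonneg (sq_nonneg _)]
              refine pow_le_pow_left₀ (norm_nonneg _) ((norm_sub_le _ _).trans (add_le_add ?_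
                (norm_partialFourier_le hconn _ _))) 2
              rw [Complex.norm_real, Real.norm_eq_abs]
              exact hconn.abs_apply_le x)
          refine h1.le.trans ?_
          unfold blockFun
          split_ifs
          · exact h_in
          · exact h_out
    _ = _ := by
        simp only [Finset.sum_add_distrib, Finset.sum_ite_eq, Finset.mem_univ, if_true,
          Finset.sum_const, Finset.card_univ, Fintype.card_fin, nsmul_eq_mul]
        ring

/-! ### The law of the graph -/

/-- Graphs form a finite type, so this makes every event measurable. -/
instance {n : ℕ} : MeasurableSingletonClass (SimpleGraph (Fin n)) := by
  refine ⟨fun G => ?_⟩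
  have h : ({G} : Set (SimpleGraph (Fin n))) = SimpleGraph.Adj ⁻¹' {G.Adj} := by
    ext H
    simp only [Set.mem_singleton_iff, Set.mem_preimage]
    exact ⟨fun h => h ▸ rfl, fun h => SimpleGraph.ext h⟩
  rw [h]
  exact ⟨{G.Adj}, measurableSet_singleton _, rfl⟩

theorem graphProb_eq_weight {d n k : ℕ} (F_in F_out : UnitAddTorus (Fin d) → ℝ) (σ : Fin n → Fin k)
    (X : Fin n → UnitAddTorus (Fin d)) (G : SimpleGraph (Fin n)) :
    graphProb F_in F_out σ X G = weight (edgeProb F_in F_out σ X) G := rfl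

theorem measurable_weight {d n k : ℕ} {F_in F_out : UnitAddTorus (Fin d) → ℝ}
    (hF_in : IsConnectivity F_in) (hF_out : IsConnectivity F_out) (σ : Fin n → Fin k)
    (G : SimpleGraph (Fin n)) : Measurable fun X => weight (edgeProb F_in F_out σ X) G := by
  have h : ∀ i j, Measurable fun X => edgeProb F_in F_out σ X i j := fun i j => by
    simp only [edgeProb_eq]
    exact (blockFun_isConnectivity hF_in hF_out _ _).measurable.comp
      (measurable_sub_positions i j)
  unfold weight
  refine Finset.measurable_fun_prod _ fun i _ => Finset.measurable_fun_prod _ fun j _ => ?_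
  split_ifs
  · exact h i j
  · exact measurable_const.sub (h i j)

open Classical in
theorem law_apply {d n k : ℕ} {F_in F_out : UnitAddTorus (Fin d) → ℝ}
    (hF_in : IsConnectivity F_in) (hF_out : IsConnectivity F_out) (σ : Fin n → Fin k)
    (E : Set (SimpleGraph (Fin n))) :
    law F_in F_out σ E = ∫⁻ X, ENNReal.ofReal
      (∑ G, weight (edgeProb F_in F_out σ X) G * if G ∈ E then 1 else 0) ∂(positions d n) := by
  have h0 := fun X (G : SimpleGraph (Fin n)) =>
    weight_nonneg (edgeProb_mem_Icc hF_in hF_out σ X) G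
  have h1 : ∀ X, ENNReal.ofReal (∑ G, weight (edgeProb F_in F_out σ X) G *
      if G ∈ E then 1 else 0) = ∑ G, ENNReal.ofReal (weight (edgeProb F_in F_out σ X) G) *
        if G ∈ E then 1 else 0 := fun X => by
    rw [ENNReal.ofReal_sum_of_nonneg fun G _ =>
      mul_nonneg (h0 X G) (by split_ifs <;> norm_num)]
    refine Finset.sum_congr rfl fun G _ => ?_
    split_ifs <;> simp
  simp only [h1]
  rw [lintegral_finsetSum _ fun G _ =>
    ((measurable_weight hF_in hF_out σ G).ennreal_ofReal.mul_const _)]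
  simp only [law, Measure.coe_finsetSum, Finset.sum_apply, Measure.smul_apply, smul_eq_mul,
    graphProb_eq_weight]
  refine Finset.sum_congr (by congr) fun G _ => ?_
  rw [lintegral_mul_const _ (measurable_weight hF_in hF_out σ G).ennreal_ofReal,
    Measure.dirac_apply' _ (Set.toFinite E).measurableSet, Set.indicator_apply]
  rfl

theorem law_univ {d n k : ℕ} {F_in F_out : UnitAddTorus (Fin d) → ℝ}
    (hF_in : IsConnectivity F_in) (hF_out : IsConnectivity F_out) (σ : Fin n → Fin k) :
    law F_in F_out σ Set.univ = 1 := by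
  rw [law_apply hF_in hF_out]
  simp [sum_weight]

-- It suffices to bound the conditional probability given the positions by an integrable function of
-- them.
open Classical in
theorem law_le {d n k : ℕ} {F_in F_out : UnitAddTorus (Fin d) → ℝ}
    (hF_in : IsConnectivity F_in) (hF_out : IsConnectivity F_out) (σ : Fin n → Fin k)
    (E : Set (SimpleGraph (Fin n))) {B : (Fin n → UnitAddTorus (Fin d)) → ℝ}
    (hB : Integrable B (positions d n))
    (hE : ∀ X, ∑ G, weight (edgeProb F_in F_out σ X) G * (if G ∈ E then 1 else 0) ≤ B X) :
    law F_in F_out σ E ≤ ENNReal.ofReal (∫ X, B X ∂(positions d n)) := by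
  have h0 : ∀ X, 0 ≤ B X := fun X => (Finset.sum_nonneg fun G _ =>
    mul_nonneg (weight_nonneg (edgeProb_mem_Icc hF_in hF_out σ X) G)
      (by split_ifs <;> norm_num)).trans (hE X)
  rw [law_apply hF_in hF_out, ofReal_integral_eq_lintegral_ofReal hB (ae_of_all _ h0)]
  exact lintegral_mono fun X => ENNReal.ofReal_le_ofReal (hE X)

/-! ### The failure probability of the algorithm -/

theorem communityResidual_eq {d n k : ℕ} (F_in F_out : UnitAddTorus (Fin d) → ℝ)
    (σ : Fin n → Fin k) (X : Fin n → UnitAddTorus (Fin d)) (G : SimpleGraph (Fin n)) :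
    communityResidual σ G (n * target k F_in F_out) =
      ∑ a, residual G (n * contrastEigval k F_in F_out 0) (modulated X σ 0 (centered a)) := by
  refine Finset.sum_congr rfl fun a _ => ?_
  refine Finset.sum_congr rfl fun i _ => ?_
  have h1 : (∑ l, (adj G i l : ℂ) * modulated X σ 0 (centered a) l) -
      n * contrastEigval k F_in F_out 0 * modulated X σ 0 (centered a) i =
      (((∑ l, adj G i l * centered a (σ l)) - n * target k F_in F_out * centered a (σ i) : ℝ) :
        ℂ) := by
    rw [contrastEigval_zero]
    push_cast
    simp [modulated, UnitAddTorus.mFourier_zero]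
  rw [h1, Complex.norm_real, Real.norm_eq_abs, sq_abs, sq]
  rfl

/-- The graphs for which some output has an absolute error larger than `L`. -/
def failure {n k : ℕ} (μ_in μ_out η : ℝ) (σ : Fin n → Fin k) (L : ℝ) :
    Set (SimpleGraph (Fin n)) :=
  {G | ∃ σ' : Fin n → Fin k, IsOutput μ_in μ_out η G σ' ∧ L < absError σ σ'}

theorem noiseSqNorm_nonneg {n : ℕ} (p : Fin n → Fin n → ℝ) (G : SimpleGraph (Fin n)) :
    0 ≤ noiseSqNorm p G :=
  Finset.sum_nonneg fun _ _ => Finset.sum_nonneg fun _ _ => sq_nonneg _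

theorem truncationError_nonneg {d n k : ℕ} (F_in F_out : UnitAddTorus (Fin d) → ℝ)
    (σ : Fin n → Fin k) (S : Finset (Fin d → ℤ)) (X : Fin n → UnitAddTorus (Fin d)) :
    0 ≤ truncationError F_in F_out σ S X :=
  Finset.sum_nonneg fun _ _ => Finset.sum_nonneg fun _ _ => sq_nonneg _

/-- On failure, the noise, the truncation error or a residual is large. -/
theorem one_le_of_mem_failure {d n k : ℕ} (hk : 2 ≤ k) {F_in F_out : UnitAddTorus (Fin d) → ℝ}
    (hF_in : IsConnectivity F_in) (hF_out : IsConnectivity F_out) {σ : Fin n → Fin k}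
    (hσ : IsBalanced σ) (X : Fin n → UnitAddTorus (Fin d)) {G : SimpleGraph (Fin n)}
    {S : Finset (Fin d → ℤ)} (h0S : (0 : Fin d → ℤ) ∈ S) {ε : ℝ} (hε : 0 < ε) (hn : 0 < n)
    (htarget : 0 < target k F_in F_out)
    (hmean : ∀ z ∈ S, 2 * ε ≤ ‖(target k F_in F_out : ℂ) - meanEigval k F_in F_out z‖)
    (hcontrast : ∀ z ∈ S, z ≠ 0 →
      2 * ε ≤ ‖(target k F_in F_out : ℂ) - contrastEigval k F_in F_out z‖)
    {t s r η L : ℝ} (ht : 0 < t) (hs : 0 < s) (hr : 0 < r) (hη : 0 < η) (hL : 0 < L)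
    (hsmall : k * (ε + t + s + 2 * r / ε ^ 2) < target k F_in F_out) (hLn : k * L < n)
    (hG : G ∈ failure (density F_in) (density F_out) η σ L) :
    1 ≤ ((n * t) ^ 4)⁻¹ * noiseSqNorm (edgeProb F_in F_out σ X) G +
      ((n * s) ^ 2)⁻¹ * truncationError F_in F_out σ S X +
      (n ^ 3 * r)⁻¹ * ∑ z ∈ S, freqResidual F_in F_out σ X G z +
      8 * (2 + η) / (L * (n * ε) ^ 2) * freqResidual F_in F_out σ X G 0 := by
  have hn' : (0 : ℝ) < n := Nat.cast_pos.2 hn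
  have a1 : 0 ≤ ((n * t) ^ 4)⁻¹ * noiseSqNorm (edgeProb F_in F_out σ X) G :=
    mul_nonneg (by positivity) (noiseSqNorm_nonneg _ _)
  have a2 : 0 ≤ ((n * s) ^ 2)⁻¹ * truncationError F_in F_out σ S X :=
    mul_nonneg (by positivity) (truncationError_nonneg _ _ _ _ _)
  have a3 : 0 ≤ ((n : ℝ) ^ 3 * r)⁻¹ * ∑ z ∈ S, freqResidual F_in F_out σ X G z :=
    mul_nonneg (by positivity) (Finset.sum_nonneg fun z _ => freqResidual_nonneg F_in F_out σ X G z)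
  have a4 : 0 ≤ 8 * (2 + η) / (L * (n * ε) ^ 2) * freqResidual F_in F_out σ X G 0 :=
    mul_nonneg (by positivity) (freqResidual_nonneg F_in F_out σ X G 0)
  -- If the sum of four nonnegative terms is below 1, so is each of them, and all the deterministic
  -- estimates apply.
  by_contra hcon
  have hinv : ∀ x y : ℝ, 0 < y → y⁻¹ * x < 1 → x ≤ y := fun x y hy h => by
    rw [inv_mul_lt_iff₀ hy, mul_one] at h
    exact h.le
  have hcard := card_near_lt (by omega) hF_in hF_out hσ X G h0S hε hn htarget hmean hcontrast
    ht.le hs.le (hinv _ _ (by positivity) (by linarith)) (hinv _ _ (by positivity) (by linarith))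
    (hinv _ _ (by positivity) (by linarith)) hsmall
  obtain ⟨σ', ⟨V, hV, hkm⟩, herr⟩ := hG
  rw [mul_div_assoc] at hV
  -- The defect ρ = L/(8(2 + η)) is the one that makes the bound of `absError_le` equal to L.
  have hc1 : 8 * (2 + η) * (L / (8 * (2 + η))) = L := by field_simp
  have hρ : communityResidual σ G (n * target k F_in F_out) / (n * ε) ^ 2 ≤ L / (8 * (2 + η)) := by
    have h1 : communityResidual σ G (n * target k F_in F_out) ≤
        freqResidual F_in F_out σ X G 0 := by
      rw [communityResidual_eq F_in F_out σ X G, freqResidual]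
      exact le_add_of_nonneg_right (residual_nonneg _ _ _)
    have h2 : 8 * (2 + η) / (L * (n * ε) ^ 2) * freqResidual F_in F_out σ X G 0 < 1 := by linarith
    rw [div_mul_eq_mul_div, div_lt_one (by positivity)] at h2
    rw [div_le_div_iff₀ (by positivity) (by positivity)]
    have h3 := mul_le_mul_of_nonneg_right h1 (show 0 ≤ 8 * (2 + η) by positivity)
    linarith
  have := absError_le hk hn hσ (mul_pos hn' hε) hη hV hcard hkm hρ (by rw [hc1]; exact hLn)
  rw [hc1] at this
  linarith

theorem sum_weight_affine {n : ℕ} (p : Fin n → Fin n → ℝ) (f g h : SimpleGraph (Fin n) → ℝ)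
    (a b c e : ℝ) :
    ∑ G, weight p G * (a * f G + b + c * g G + e * h G) =
      a * ∑ G, weight p G * f G + b + c * ∑ G, weight p G * g G + e * ∑ G, weight p G * h G := by
  have h1 : ∀ G, weight p G * (a * f G + b + c * g G + e * h G) =
      a * (weight p G * f G) + weight p G * b + c * (weight p G * g G) + e * (weight p G * h G) :=
    fun G => by ring
  simp only [h1, Finset.sum_add_distrib, ← Finset.mul_sum, ← Finset.sum_mul, sum_weight, one_mul]

/-- Markov's inequality: the indicator of failure is at most the sum in `one_le_of_mem_failure`,
which is averaged over the edges and then over the positions. The residual at frequency zero has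
mean O(n²) and is divided by L(nε)², whence a term in 1/L alone. -/
theorem law_failure_le {d n k : ℕ} (hk : 2 ≤ k) {F_in F_out : UnitAddTorus (Fin d) → ℝ}
    (hF_in : IsConnectivity F_in) (hF_out : IsConnectivity F_out) {σ : Fin n → Fin k}
    (hσ : IsBalanced σ)
    {S : Finset (Fin d → ℤ)} (h0S : (0 : Fin d → ℤ) ∈ S) {ε : ℝ} (hε : 0 < ε) (hn : 0 < n)
    (htarget : 0 < target k F_in F_out)
    (hmean : ∀ z ∈ S, 2 * ε ≤ ‖(target k F_in F_out : ℂ) - meanEigval k F_in F_out z‖)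
    (hcontrast : ∀ z ∈ S, z ≠ 0 →
      2 * ε ≤ ‖(target k F_in F_out : ℂ) - contrastEigval k F_in F_out z‖)
    {t s r η L κ : ℝ} (ht : 0 < t) (hs : 0 < s) (hr : 0 < r) (hη : 0 < η) (hL : 0 < L)
    (hsmall : k * (ε + t + s + 2 * r / ε ^ 2) < target k F_in F_out) (hLn : k * L < n)
    (hκ_in : ∫ x, ‖(F_in x : ℂ) - partialFourier F_in S x‖ ^ 2 ∂(torusMeasure d) ≤ κ)
    (hκ_out : ∫ x, ‖(F_out x : ℂ) - partialFourier F_out S x‖ ^ 2 ∂(torusMeasure d) ≤ κ) :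
    law F_in F_out σ (failure (density F_in) (density F_out) η σ L) ≤ ENNReal.ofReal
      (κ / s ^ 2 + (2 / t ^ 4 + (1 + S.card) ^ 2 / s ^ 2 + 40 * S.card * (k + 1) / r) / n +
        320 * (2 + η) * (k + 1) / ε ^ 2 / L) := by
  classical
  have hn' : (0 : ℝ) < n := Nat.cast_pos.2 hn
  set B : (Fin n → UnitAddTorus (Fin d)) → ℝ := fun X =>
    ((n * t) ^ 4)⁻¹ * (2 * (n : ℝ) ^ 3) + ((n * s) ^ 2)⁻¹ * truncationError F_in F_out σ S X +
      (n ^ 3 * r)⁻¹ * ∑ z ∈ S, freqResidualBound F_in F_out σ z X +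
      8 * (2 + η) / (L * (n * ε) ^ 2) * freqResidualBound F_in F_out σ 0 X with hB
  have i2 := (integrable_truncationError hF_in hF_out σ S).const_mul ((n * s) ^ 2)⁻¹
  have i3 := (integrable_finsetSum S fun z _ =>
    integrable_freqResidualBound hF_in hF_out σ z).const_mul ((n : ℝ) ^ 3 * r)⁻¹
  have i4 := (integrable_freqResidualBound hF_in hF_out σ 0).const_mul
    (8 * (2 + η) / (L * (n * ε) ^ 2))
  have i1 : Integrable (fun _ => ((n * t) ^ 4)⁻¹ * (2 * (n : ℝ) ^ 3)) (positions d n) :=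
    integrable_const _
  have i12 : Integrable (fun X => ((n * t) ^ 4)⁻¹ * (2 * (n : ℝ) ^ 3) +
      ((n * s) ^ 2)⁻¹ * truncationError F_in F_out σ S X) (positions d n) := i1.add i2
  have i123 : Integrable (fun X => ((n * t) ^ 4)⁻¹ * (2 * (n : ℝ) ^ 3) +
      ((n * s) ^ 2)⁻¹ * truncationError F_in F_out σ S X +
      (n ^ 3 * r)⁻¹ * ∑ z ∈ S, freqResidualBound F_in F_out σ z X) (positions d n) := i12.add i3
  have hBint : Integrable B (positions d n) := i123.add i4
  have hmean_le : ∀ X, ∑ G, weight (edgeProb F_in F_out σ X) G *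
      (if G ∈ failure (density F_in) (density F_out) η σ L then 1 else 0) ≤ B X := by
    intro X
    have hp := edgeProb_mem_Icc hF_in hF_out σ X
    set T := truncationError F_in F_out σ S X with hT
    calc _ ≤ ∑ G, weight (edgeProb F_in F_out σ X) G *
          (((n * t) ^ 4)⁻¹ * noiseSqNorm (edgeProb F_in F_out σ X) G + ((n * s) ^ 2)⁻¹ * T +
            (n ^ 3 * r)⁻¹ * ∑ z ∈ S, freqResidual F_in F_out σ X G z +
            8 * (2 + η) / (L * (n * ε) ^ 2) * freqResidual F_in F_out σ X G 0) := by
          refine Finset.sum_le_sum fun G _ => mul_le_mul_of_nonneg_left ?_ (weight_nonneg hp G)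
          split_ifs with h
          · exact one_le_of_mem_failure hk hF_in hF_out hσ X h0S hε hn htarget hmean hcontrast
              ht hs hr hη hL hsmall hLn h
          · refine add_nonneg (add_nonneg (add_nonneg ?_ ?_) ?_) ?_
            · exact mul_nonneg (by positivity) (noiseSqNorm_nonneg _ _)
            · exact mul_nonneg (by positivity) (truncationError_nonneg _ _ _ _ _)
            · exact mul_nonneg (by positivity)
                (Finset.sum_nonneg fun z _ => freqResidual_nonneg F_in F_out σ X G z)
            · exact mul_nonneg (by positivity) (freqResidual_nonneg F_in F_out σ X G 0)
      _ = ((n * t) ^ 4)⁻¹ * (∑ G, weight (edgeProb F_in F_out σ X) G *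
            noiseSqNorm (edgeProb F_in F_out σ X) G) + ((n * s) ^ 2)⁻¹ * T +
          (n ^ 3 * r)⁻¹ * (∑ z ∈ S, ∑ G, weight (edgeProb F_in F_out σ X) G *
            freqResidual F_in F_out σ X G z) +
          8 * (2 + η) / (L * (n * ε) ^ 2) * (∑ G, weight (edgeProb F_in F_out σ X) G *
            freqResidual F_in F_out σ X G 0) := by
          rw [sum_weight_affine, Finset.sum_comm (s := S)]
          simp only [Finset.mul_sum]
      _ ≤ B X := by
          have h1 := sum_weight_noiseSqNorm_le hp (edgeProb_symm hF_in hF_out σ X)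
          have h2 := fun z => sum_weight_freqResidual_le (by omega) hF_in hF_out hσ X z
          exact add_le_add (add_le_add (add_le_add
            (mul_le_mul_of_nonneg_left h1 (by positivity)) le_rfl)
            (mul_le_mul_of_nonneg_left (Finset.sum_le_sum fun z _ => h2 z) (by positivity)))
            (mul_le_mul_of_nonneg_left (h2 0) (by positivity))
  refine (law_le hF_in hF_out σ _ hBint hmean_le).trans (ENNReal.ofReal_le_ofReal ?_)
  have e1 : ∫ X, B X ∂(positions d n) = ((n * t) ^ 4)⁻¹ * (2 * (n : ℝ) ^ 3) +
      ((n * s) ^ 2)⁻¹ * (∫ X, truncationError F_in F_out σ S X ∂(positions d n)) +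
      (n ^ 3 * r)⁻¹ * (∑ z ∈ S, ∫ X, freqResidualBound F_in F_out σ z X ∂(positions d n)) +
      8 * (2 + η) / (L * (n * ε) ^ 2) *
        (∫ X, freqResidualBound F_in F_out σ 0 X ∂(positions d n)) := by
    rw [integral_add i123 i4, integral_add i12 i3, integral_add i1 i2,
      integral_const, probReal_univ, one_smul, integral_const_mul, integral_const_mul,
      integral_const_mul,
      integral_finsetSum S fun z _ => integrable_freqResidualBound hF_in hF_out σ z]
  have e2 := integral_truncationError_le hF_in hF_out σ S hκ_in hκ_out
  have e3 := fun z => integral_freqResidualBound_le (n := n) hF_in hF_out σ z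
  have e4 : ∑ z ∈ S, ∫ X, freqResidualBound F_in F_out σ z X ∂(positions d n) ≤
      S.card * ((k + 1) * (40 * (n : ℝ) ^ 2)) := by
    have := Finset.sum_le_sum fun z (_ : z ∈ S) => e3 z
    rwa [Finset.sum_const, nsmul_eq_mul] at this
  rw [e1]
  calc _ ≤ ((n * t) ^ 4)⁻¹ * (2 * (n : ℝ) ^ 3) +
      ((n * s) ^ 2)⁻¹ * (n * (1 + S.card) ^ 2 + n ^ 2 * κ) +
      (n ^ 3 * r)⁻¹ * (S.card * ((k + 1) * (40 * (n : ℝ) ^ 2))) +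
      8 * (2 + η) / (L * (n * ε) ^ 2) * ((k + 1) * (40 * (n : ℝ) ^ 2)) := by
        exact add_le_add (add_le_add (add_le_add le_rfl
          (mul_le_mul_of_nonneg_left e2 (by positivity)))
          (mul_le_mul_of_nonneg_left e4 (by positivity)))
          (mul_le_mul_of_nonneg_left (e3 0) (by positivity))
    _ = _ := by
        field_simp
        ring

theorem exists_pos_forall_le {ι : Type*} (S : Finset ι) (f : ι → ℝ) (hf : ∀ i ∈ S, 0 < f i) :
    ∃ ε : ℝ, 0 < ε ∧ ∀ i ∈ S, ε ≤ f i := by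
  rcases S.eq_empty_or_nonempty with rfl | hS
  · exact ⟨1, one_pos, by simp⟩
  · obtain ⟨i, hi, hmin⟩ := S.exists_min_image f hS
    exact ⟨f i, hf i hi, hmin⟩

/-- The failure probability tends to zero when the allowed error tends to infinity. -/
theorem tendsto_law_failure {d k : ℕ} (hk : 2 ≤ k) {F_in F_out : UnitAddTorus (Fin d) → ℝ}
    (hF_in : IsConnectivity F_in) (hF_out : IsConnectivity F_out)
    (hμ : density F_out < density F_in)
    (h_ne : ∀ z : Fin d → ℤ, fourierCoeff F_in z + ((k : ℂ) - 1) * fourierCoeff F_out z ≠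
      ((density F_in - density F_out : ℝ) : ℂ))
    (h_ne' : ∀ z : Fin d → ℤ, z ≠ 0 → fourierCoeff F_in z - fourierCoeff F_out z ≠
      ((density F_in - density F_out : ℝ) : ℂ))
    {η : ℝ} (hη : 0 < η) {σ : (m : ℕ) → Fin (k * m) → Fin k} (hσ : ∀ m, IsBalanced (σ m))
    {L : ℕ → ℝ} (hL : Tendsto L atTop atTop) (hLm : ∀ᶠ m : ℕ in atTop, L m < m) :
    Tendsto (fun m : ℕ => law F_in F_out (σ m)
      (failure (density F_in) (density F_out) η (σ m) (L m))) atTop (𝓝 0) := by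
  have hk' : (0 : ℝ) < k := Nat.cast_pos.2 (by omega)
  have hkc : (k : ℂ) ≠ 0 := Nat.cast_ne_zero.2 (by omega)
  have htarget : 0 < target k F_in F_out := div_pos (sub_pos.2 hμ) hk'
  set lam := target k F_in F_out with hlam
  have hlamc : (lam : ℂ) = ((density F_in - density F_out : ℝ) : ℂ) / k := by
    rw [hlam, target]
    push_cast
    rfl
  -- The four terms in `hsmall` will each be at most λ/(8k), so that k times their sum is at most
  -- λ/2.
  set s : ℝ := lam / (8 * k) with hsdef
  have hs : 0 < s := by positivity
  rw [ENNReal.tendsto_nhds_zero]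
  intro δ hδ
  rcases eq_or_ne δ ⊤ with rfl | hδtop
  · exact Eventually.of_forall fun _ => le_top
  have hδ' : 0 < δ.toReal := ENNReal.toReal_pos hδ.ne' hδtop
  -- The truncation accuracy is chosen so that κ/s² is half of the allowed probability δ. The set S
  -- is chosen next, then ε from the finitely many gaps over S, and only afterwards is m taken
  -- large.
  have hκ : 0 < δ.toReal / 2 * s ^ 2 := by positivity
  have hev := ((tendsto_integral_partialFourier hF_in).eventually_le_const hκ).and
    (((tendsto_integral_partialFourier hF_out).eventually_le_const hκ).and
      (eventually_ge_atTop ({0} : Finset (Fin d → ℤ))))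
  obtain ⟨S, hS_in, hS_out, hS0⟩ := hev.exists
  have h0S : (0 : Fin d → ℤ) ∈ S := hS0 (Finset.mem_singleton_self 0)
  obtain ⟨ε₁, hε₁, hmean⟩ := exists_pos_forall_le S
    (fun z => ‖(lam : ℂ) - meanEigval k F_in F_out z‖) fun z _ => by
      rw [norm_pos_iff, sub_ne_zero, hlamc, meanEigval, ne_eq, div_left_inj' hkc]
      exact (h_ne z).symm
  obtain ⟨ε₂, hε₂, hcontrast⟩ := exists_pos_forall_le (S.erase 0)
    (fun z => ‖(lam : ℂ) - contrastEigval k F_in F_out z‖) fun z hz => by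
      rw [norm_pos_iff, sub_ne_zero, hlamc, contrastEigval, ne_eq, div_left_inj' hkc]
      exact (h_ne' z (Finset.ne_of_mem_erase hz)).symm
  set ε : ℝ := min (min (ε₁ / 2) (ε₂ / 2)) s with hεdef
  have hε : 0 < ε := lt_min (lt_min (half_pos hε₁) (half_pos hε₂)) hs
  have hεs : ε ≤ s := min_le_right _ _
  have hεε₁ : 2 * ε ≤ ε₁ := by
    have : ε ≤ ε₁ / 2 := (min_le_left _ _).trans (min_le_left _ _)
    linarith
  have hεε₂ : 2 * ε ≤ ε₂ := by
    have : ε ≤ ε₂ / 2 := (min_le_left _ _).trans (min_le_right _ _)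
    linarith
  -- Chosen so that 2r/ε² = s.
  set r : ℝ := ε ^ 2 * s / 2 with hrdef
  have hr : 0 < r := by positivity
  have hsmall : k * (ε + s + s + 2 * r / ε ^ 2) < lam := by
    have h1 : 2 * r / ε ^ 2 = s := by
      rw [hrdef]
      field_simp
    have h2 : k * s = lam / 8 := by
      rw [hsdef]
      field_simp
    rw [h1]
    have h3 := mul_le_mul_of_nonneg_left hεs hk'.le
    linarith
  set c₁ : ℝ := 2 / s ^ 4 + (1 + S.card) ^ 2 / s ^ 2 + 40 * S.card * (k + 1) / r with hc₁
  set c₂ : ℝ := 320 * (2 + η) * (k + 1) / ε ^ 2 with hc₂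
  have hn : Tendsto (fun m : ℕ => ((k * m : ℕ) : ℝ)) atTop atTop :=
    tendsto_natCast_atTop_atTop.comp (tendsto_id.const_mul_atTop' (by omega))
  have hlim : Tendsto (fun m : ℕ => δ.toReal / 2 + c₁ / ((k * m : ℕ) : ℝ) + c₂ / L m) atTop
      (𝓝 (δ.toReal / 2 + 0 + 0)) :=
    (tendsto_const_nhds.add (tendsto_const_nhds.div_atTop hn)).add
      (tendsto_const_nhds.div_atTop hL)
  have hlt : δ.toReal / 2 + 0 + 0 < δ.toReal := by linarith
  filter_upwards [hlim.eventually_lt_const hlt, hLm, hL.eventually_gt_atTop 0,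
    eventually_gt_atTop 0] with m hm hLm hL0 hm0
  have hLn : (k : ℝ) * L m < ((k * m : ℕ) : ℝ) := by
    push_cast
    exact mul_lt_mul_of_pos_left hLm hk'
  refine (law_failure_le hk hF_in hF_out (hσ m) h0S hε (Nat.mul_pos (by omega) hm0) htarget
    (fun z hz => hεε₁.trans (hmean z hz))
    (fun z hz hz0 => hεε₂.trans (hcontrast z (Finset.mem_erase.2 ⟨hz0, hz⟩)))
    hs hs hr hη hL0 hsmall hLn hS_in hS_out).trans ?_
  refine ENNReal.ofReal_le_of_le_toReal ?_
  have h1 : δ.toReal / 2 * s ^ 2 / s ^ 2 = δ.toReal / 2 := by field_simp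
  rw [h1]
  exact hm.le

end
end SGBM

/-! ### Deduction of both conclusions with threshold log n -/

theorem mainTheorem5 (d k : ℕ) (hd : 1 ≤ d) (hk : 2 ≤ k)
    (F_in F_out : UnitAddTorus (Fin d) → ℝ)
    (hF_in : SGBM.IsConnectivity F_in) (hF_out : SGBM.IsConnectivity F_out)
    (hμ_out : 0 < SGBM.density F_out) (hμ : SGBM.density F_out < SGBM.density F_in)
    (h_in : SGBM.EqFourierSeriesAtZero F_in) (h_out : SGBM.EqFourierSeriesAtZero F_out)
    (h_ne : ∀ z : Fin d → ℤ,
      SGBM.fourierCoeff F_in z + ((k : ℂ) - 1) * SGBM.fourierCoeff F_out z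
        ≠ ((SGBM.density F_in - SGBM.density F_out : ℝ) : ℂ))
    (h_ne' : ∀ z : Fin d → ℤ, z ≠ 0 →
      SGBM.fourierCoeff F_in z - SGBM.fourierCoeff F_out z
        ≠ ((SGBM.density F_in - SGBM.density F_out : ℝ) : ℂ))
    (η : ℝ) (hη : 0 < η) :
    (∀ σ : (m : ℕ) → Fin (k * m) → Fin k, (∀ m, SGBM.IsBalanced (σ m)) →
      ∀ ε : ℝ, 0 < ε →
        Tendsto (fun m : ℕ => SGBM.law F_in F_out (σ m)
          {G | ∃ σ' : Fin (k * m) → Fin k,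
            SGBM.IsOutput (SGBM.density F_in) (SGBM.density F_out) η G σ' ∧
              ε < SGBM.lossRate (σ m) σ'})
          atTop (𝓝 0)) ∧
    ∃ C : ℝ, 0 < C ∧
      ∀ σ : (m : ℕ) → Fin (k * m) → Fin k, (∀ m, SGBM.IsBalanced (σ m)) →
        Tendsto (fun m : ℕ => SGBM.law F_in F_out (σ m)
          {G | ∀ σ' : Fin (k * m) → Fin k,
            SGBM.IsOutput (SGBM.density F_in) (SGBM.density F_out) η G σ' →
              (SGBM.absError (σ m) σ' : ℝ) ≤ C * (k : ℝ) ^ 5 * Real.log ((k * m : ℕ) : ℝ)})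
          atTop (𝓝 1) := by
  have hk' : (1 : ℝ) ≤ k := by exact_mod_cast (by omega : 1 ≤ k)
  have hn : Tendsto (fun m : ℕ => ((k * m : ℕ) : ℝ)) atTop atTop :=
    tendsto_natCast_atTop_atTop.comp (tendsto_id.const_mul_atTop' (by omega))
  have hlog : Tendsto (fun m : ℕ => Real.log ((k * m : ℕ) : ℝ)) atTop atTop :=
    Real.tendsto_log_atTop.comp hn
  -- Used with c = 1/k, to get log n < m for n = km, and with the loss threshold ε, to deduce weak
  -- consistency.
  have hsub : ∀ c : ℝ, 0 < c → ∀ᶠ m : ℕ in atTop,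
      Real.log ((k * m : ℕ) : ℝ) < c * ((k * m : ℕ) : ℝ) := by
    intro c hc
    have h1 := hn.eventually (Real.isLittleO_log_id_atTop.bound (half_pos hc))
    filter_upwards [h1, hn.eventually_gt_atTop 0] with m hm hm0
    rw [id, Real.norm_eq_abs, Real.norm_eq_abs, abs_of_pos hm0] at hm
    have h2 := mul_pos hc hm0
    linarith [le_abs_self (Real.log ((k * m : ℕ) : ℝ))]
  have hfail : ∀ σ : (m : ℕ) → Fin (k * m) → Fin k, (∀ m, SGBM.IsBalanced (σ m)) →
      Tendsto (fun m : ℕ => SGBM.law F_in F_out (σ m) (SGBM.failure (SGBM.density F_in)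
        (SGBM.density F_out) η (σ m) (Real.log ((k * m : ℕ) : ℝ)))) atTop (𝓝 0) := by
    intro σ hσ
    refine SGBM.tendsto_law_failure hk hF_in hF_out hμ h_ne h_ne' hη hσ hlog ?_
    filter_upwards [hsub (1 / k) (by positivity)] with m hm
    refine hm.trans_eq ?_
    push_cast
    field_simp
  -- Errors above log n already have vanishing probability, so C = 1 suffices: k⁵ ≥ 1.
  refine ⟨fun σ hσ ε hε => ?_, 1, one_pos, fun σ hσ => ?_⟩
  · refine tendsto_of_tendsto_of_tendsto_of_le_of_le' tendsto_const_nhds (hfail σ hσ)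
      (Eventually.of_forall fun _ => bot_le) ?_
    filter_upwards [hsub ε hε, hn.eventually_gt_atTop 0] with m hm hm0
    refine measure_mono ?_
    rintro G ⟨σ', hout, herr⟩
    refine ⟨σ', hout, hm.trans ?_⟩
    rwa [SGBM.lossRate, lt_div_iff₀ hm0] at herr
  · have hcompl : Tendsto (fun m : ℕ => 1 - SGBM.law F_in F_out (σ m) (SGBM.failure
        (SGBM.density F_in) (SGBM.density F_out) η (σ m) (Real.log ((k * m : ℕ) : ℝ))))
        atTop (𝓝 (1 - 0)) :=
      ENNReal.Tendsto.sub tendsto_const_nhds (hfail σ hσ) (Or.inl ENNReal.one_ne_top)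
    rw [tsub_zero] at hcompl
    refine tendsto_of_tendsto_of_tendsto_of_le_of_le' hcompl tendsto_const_nhds ?_
      (Eventually.of_forall fun m => ?_)
    · filter_upwards [hlog.eventually_ge_atTop 0] with m hm
      -- The good event and the failure event cover everything, so subadditivity gives the lower
      -- bound.
      rw [tsub_le_iff_right, ← SGBM.law_univ hF_in hF_out (σ m)]
      refine (measure_mono ?_).trans (measure_union_le _ _)
      intro G _
      by_cases hG : G ∈ SGBM.failure (SGBM.density F_in) (SGBM.density F_out) η (σ m)
          (Real.log ((k * m : ℕ) : ℝ))
      · exact Or.inr hG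
      · refine Or.inl fun σ' hout => ?_
        by_contra hcon
        refine hG ⟨σ', hout, lt_of_le_of_lt ?_ (not_le.1 hcon)⟩
        rw [one_mul]
        exact le_mul_of_one_le_left hm (one_le_pow₀ hk')
    · rw [← SGBM.law_univ hF_in hF_out (σ m)]
      exact measure_mono (Set.subset_univ _)
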